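/- Fix an integer $p\ge 2$. For a commutative ring $A$ let $\mathscr H_A$ be the ring of Hahn series $\sum_{\gamma\in\mathbb Q}f_\gamma z^\gamma$ with coefficients in $A$ and value group $\mathbb Q$, with $z$-adic valuation $\operatorname{val}_z$ and the ring automorphism $\phi_p(\sum f_\gamma z^\gamma)=\sum f_\gamma z^{p\gamma}$ (for $A$ any of the rings below); put $\mathscr H=\mathscr H_{\mathbb C}$. Rings. Let $\mathscr R_\lambda=\mathscr H_{\mathbb C(\lambda)}[X,\partial_\lambda X,\partial_\lambda^2X,\dots]$ be the ring of differential polynomials, with the derivation $\partial_\lambda$ extending the coefficientwise $\partial/\partial\lambda$ on $\mathscr H_{\mathbb C(\lambda)}$, and with $\phi_p$ extended by $\phi_p(\partial_\lambda^iX)=\partial_\lambda^i(\lambda X)$; write $e_\lambda=X$. Let $\mathscr R$ be any commutative ring containing $\mathscr H$, with a ring automorphism $\phi_p$ extending that of $\mathscr H$, and with nonzero elements $\ell_{c,i}$ ($c\in\mathbb C^\times$, $i\ge0$) such that $\phi_p(\ell_{c,i})=c\,\ell_{c,i}+\ell_{c,i-1}$, where $\ell_{c,-1}=0$. For $c\in\mathbb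 C^\times$ let $\mathscr R_{\lambda,c}=\mathscr H_{\mathbb C[\lambda]_{(\lambda-c)}}[X,\partial_\lambda X,\dots]\subset\mathscr R_\lambda$, where $\mathbb C[\lambda]_{(\lambda-c)}$ is the ring of rational functions regular at $c$, and let $\operatorname{ev}_c:\mathscr R_{\lambda,c}\to\mathscr R$ be the ring morphism with $\operatorname{ev}_c(f(\lambda,z))=f(c,z)$ for $f\in\mathscr H_{\mathbb C[\lambda]_{(\lambda-c)}}$ and $\operatorname{ev}_c(\partial_\lambda^i(e_\lambda)/i!)=\ell_{c,i}$. Operator. Let $L=a_n(z)\phi_p^n+\dots+a_0(z)$ with $n\ge0$, $a_i\in\mathscr H$ and $a_0a_n\ne0$. Its Newton polygon is the convex hull in $\mathbb R^2$ of the points $(p^i,y)$ with $0\le i\le n$, $a_i\neq 0$, $y\ge\operatorname{val}_z(a_i)$. Let $v_i=(p^{\alpha_i},\operatorname{val}_z(a_{\alpha_i}))$, $0=\alpha_0<\dots<\alpha_k=n$, be its vertices; the slopes of $L$ are the slopes $\mu_1<\dots<\mu_k$ of the vectors $v_j-v_{j-1}$, with multiplicities $r_j=\alpha_j-\alpha_{j-1}$.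 For $1\le j\le k$ put $b_i=z^{-(p^i-1)\mu_j}a_i$ and $v=\min_i\operatorname{val}_z(b_i)$, and let $\chi_j(T)\in\mathbb C[T]$ be the value at $z=0$ of $z^{-v}\sum_ib_iT^i$. The exponents attached to $\mu_j$ are the roots of $\chi_j$ in $\mathbb C^\times$; let $m_{c,j}$ be the multiplicity of $c\in\mathbb C^\times$ as a root of $\chi_j$ ($0$ if $c$ is not a root). Put $s_{c,j}=m_{c,1}+\dots+m_{c,j-1}$ and $$\nu_j=(p-1)\bigl(p^{r_1+\dots+r_{j-1}}(\mu_j-\mu_{j-1})+\dots+p^{r_1}(\mu_2-\mu_1)+\mu_1\bigr).$$ Statement. Let $1\le j\le k$ and let $c\in\mathbb C^\times$ be an exponent attached to $\mu_j$. There is a unique $g_{c,j}(\lambda,z)\in\mathscr H_{\mathbb C(\lambda)}$ with $$L(g_{c,j}(\lambda,z)e_\lambda)=z^{\operatorname{val}_z(a_0)-\frac{\nu_j}{p-1}}(\lambda-c)^{s_{c,j}+m_{c,j}}e_\lambda ,$$ and $g_{c,j}(\lambda,z)e_\lambda\in\mathscr R_{\lambda,c}$. For every $m\in\{0,\dots,m_{c,j}-1\}$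 the element $\partial_\lambda^{s_{c,j}+m}(g_{c,j}(\lambda,z)e_\lambda)$ lies in $\mathscr R_{\lambda,c}$, and $$y_{c,j,m}=\operatorname{ev}_c\bigl(\partial_\lambda^{s_{c,j}+m}(g_{c,j}(\lambda,z)e_\lambda)\bigr)\in\mathscr R$$ is a solution of $L(y)=0$. -/

import Mathlib

open Polynomial (derivative)

noncomputable section

namespace MahlerFrobenius

/-! ## Hahn series with value group `ℚ` -/

/-- The ring of Hahn series with coefficients in `A` and value group `ℚ`. -/
abbrev Hahn (A : Type*) [Zero A] := HahnSeries ℚ A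

/-- Coefficientwise application of a ring homomorphism. -/
def hahnMap {A B : Type*} [CommRing A] [CommRing B] (f : A →+* B) : Hahn A →+* Hahn B where
  toFun x := x.map f
  map_one' := by
    ext γ
    simp only [HahnSeries.map_coeff, HahnSeries.coeff_one]
    split_ifs <;> simp
  map_zero' := by ext γ; simp
  map_add' x y := by ext γ; simp
  map_mul' x y := by
    ext γ
    have hx : (x.map f).support ⊆ x.support := fun g hg h => hg (by simp_all)
    have hy : (y.map f).support ⊆ y.support := fun g hg h => hg (by simp_all)
    rw [HahnSeries.map_coeff, HahnSeries.coeff_mul,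
      HahnSeries.coeff_mul_left' x.isPWO_support hx, map_sum]
    symm
    refine Finset.sum_subset_zero_on_sdiff ?_ ?_ ?_
    · intro q hq
      simp only [Finset.mem_antidiagonal] at hq ⊢
      exact ⟨hq.1, hy hq.2.1, hq.2.2⟩
    · intro q hq
      simp only [Finset.mem_sdiff, Finset.mem_antidiagonal, not_and] at hq
      have : (y.map f).coeff q.2 = 0 := by
        by_contra h
        exact hq.2 hq.1.1 h hq.1.2.2
      rw [HahnSeries.map_coeff] at this
      simp [this]
    · intro q _
      simp

@[simp]
theorem hahnMap_coeff {A B : Type*} [CommRing A] [CommRing B] (f : A →+* B) (x : Hahn A) (γ : ℚ) :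
    (hahnMap f x).coeff γ = f (x.coeff γ) := rfl

/-- The operator `φ_p : ∑ f_γ z^γ ↦ ∑ f_γ z^{pγ}` on Hahn series. -/
def mahler {p : ℕ} (hp : 2 ≤ p) (A : Type*) [CommRing A] : Hahn A →+* Hahn A :=
  HahnSeries.embDomainRingHom (AddMonoidHom.mulLeft (p : ℚ))
    (fun x y h => by
      have h' : (p : ℚ) * x = p * y := h
      have hp0 : (p : ℚ) ≠ 0 := by exact_mod_cast (by omega : p ≠ 0)
      exact mul_left_cancel₀ hp0 h')
    (fun x y => by
      have hp0 : (0 : ℚ) < p := by exact_mod_cast (by omega : 0 < p)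
      exact mul_le_mul_iff_right₀ hp0)

theorem mahler_coeff {p : ℕ} (hp : 2 ≤ p) {A : Type*} [CommRing A] (f : Hahn A) (γ : ℚ) :
    (mahler hp A f).coeff (p * γ) = f.coeff γ :=
  HahnSeries.embDomain_mk_coeff (f := fun x : ℚ => (p : ℚ) * x) _ _

/-- Coefficientwise application of an additive map (in practice a derivation). -/
def hahnDeriv {A : Type*} [CommRing A] (d : A →+ A) : Hahn A →+ Hahn A where
  toFun x := x.map d
  map_zero' := by ext γ; simp
  map_add' x y := by ext γ; simp

@[simp]
theorem hahnDeriv_coeff {A : Type*} [CommRing A] (d : A →+ A) (x : Hahn A) (γ : ℚ) :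
    (hahnDeriv d x).coeff γ = d (x.coeff γ) := rfl

theorem hahnDeriv_mul {A : Type*} [CommRing A] (d : A →+ A)
    (hd : ∀ a b, d (a * b) = a * d b + b * d a) (x y : Hahn A) :
    hahnDeriv d (x * y) = x * hahnDeriv d y + y * hahnDeriv d x := by
  ext γ
  have hx : (hahnDeriv d x).support ⊆ x.support := fun g hg h => hg (by simp_all)
  have hy : (hahnDeriv d y).support ⊆ y.support := fun g hg h => hg (by simp_all)
  rw [mul_comm y, hahnDeriv_coeff, HahnSeries.coeff_add, HahnSeries.coeff_mul,
    HahnSeries.coeff_mul_left' x.isPWO_support hx,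
    HahnSeries.coeff_mul_right' y.isPWO_support hy, map_sum, ← Finset.sum_add_distrib]
  refine Finset.sum_congr rfl fun q _ => ?_
  rw [hd, hahnDeriv_coeff, hahnDeriv_coeff, mul_comm (y.coeff q.2)]

/-! ## Rational functions of `λ` -/

/-- The derivative of a rational function, by the quotient rule. -/
def ratDerivFun (f : RatFunc ℂ) : RatFunc ℂ :=
  (algebraMap _ (RatFunc ℂ) (derivative f.num) * algebraMap _ (RatFunc ℂ) f.denom
    - algebraMap _ (RatFunc ℂ) f.num * algebraMap _ (RatFunc ℂ) (derivative f.denom))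
    / algebraMap _ (RatFunc ℂ) f.denom ^ 2

theorem ratDerivFun_div (a b : Polynomial ℂ) (hb : b ≠ 0) :
    ratDerivFun (algebraMap _ (RatFunc ℂ) a / algebraMap _ (RatFunc ℂ) b) =
      (algebraMap _ (RatFunc ℂ) (derivative a) * algebraMap _ (RatFunc ℂ) b
        - algebraMap _ (RatFunc ℂ) a * algebraMap _ (RatFunc ℂ) (derivative b))
        / algebraMap _ (RatFunc ℂ) b ^ 2 := by
  set f := algebraMap _ (RatFunc ℂ) a / algebraMap _ (RatFunc ℂ) b with hf
  have hd : f.denom ≠ 0 := f.denom_ne_zero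
  have hb' : algebraMap _ (RatFunc ℂ) b ≠ 0 := RatFunc.algebraMap_ne_zero hb
  have hd' : algebraMap _ (RatFunc ℂ) f.denom ≠ 0 := RatFunc.algebraMap_ne_zero hd
  have e1 : algebraMap _ (RatFunc ℂ) f.num * algebraMap _ (RatFunc ℂ) b =
      algebraMap _ (RatFunc ℂ) a * algebraMap _ (RatFunc ℂ) f.denom := by
    have := f.num_div_denom
    rw [hf, div_eq_div_iff hd' hb'] at this
    exact this
  have e2 : f.num * b = a * f.denom := by
    apply RatFunc.algebraMap_injective ℂ
    simpa using e1
  have e3 := congrArg (fun q => algebraMap _ (RatFunc ℂ) (derivative q)) e2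
  simp only [Polynomial.derivative_mul, map_add, map_mul] at e3
  unfold ratDerivFun
  rw [div_eq_div_iff (pow_ne_zero _ hd') (pow_ne_zero _ hb')]
  generalize algebraMap _ (RatFunc ℂ) f.num = N at *
  generalize algebraMap _ (RatFunc ℂ) f.denom = D at *
  generalize algebraMap _ (RatFunc ℂ) (derivative f.num) = N' at *
  generalize algebraMap _ (RatFunc ℂ) (derivative f.denom) = D' at *
  generalize algebraMap _ (RatFunc ℂ) a = A at *
  generalize algebraMap _ (RatFunc ℂ) b = B at *
  generalize algebraMap _ (RatFunc ℂ) (derivative a) = A' at *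
  generalize algebraMap _ (RatFunc ℂ) (derivative b) = B' at *
  linear_combination (D * B) * e3 - (D' * B + D * B') * e1

/-- The derivation `d/dλ` of `ℂ(λ)`. -/
def ratDeriv : RatFunc ℂ →+ RatFunc ℂ where
  toFun := ratDerivFun
  map_zero' := by simp [ratDerivFun]
  map_add' x y := by
    have hx : algebraMap _ (RatFunc ℂ) x.denom ≠ 0 :=
      RatFunc.algebraMap_ne_zero x.denom_ne_zero
    have hy : algebraMap _ (RatFunc ℂ) y.denom ≠ 0 :=
      RatFunc.algebraMap_ne_zero y.denom_ne_zero
    have e : x + y = algebraMap _ (RatFunc ℂ) (x.num * y.denom + y.num * x.denom)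
        / algebraMap _ (RatFunc ℂ) (x.denom * y.denom) := by
      conv_lhs => rw [← x.num_div_denom, ← y.num_div_denom]
      simp only [map_add, map_mul]
      field_simp
    rw [e, ratDerivFun_div _ _ (mul_ne_zero x.denom_ne_zero y.denom_ne_zero)]
    simp only [ratDerivFun, map_add, map_mul, Polynomial.derivative_mul]
    field_simp
    ring

theorem ratDeriv_mul (x y : RatFunc ℂ) :
    ratDeriv (x * y) = x * ratDeriv y + y * ratDeriv x := by
  have hx : algebraMap _ (RatFunc ℂ) x.denom ≠ 0 :=
    RatFunc.algebraMap_ne_zero x.denom_ne_zero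
  have hy : algebraMap _ (RatFunc ℂ) y.denom ≠ 0 :=
    RatFunc.algebraMap_ne_zero y.denom_ne_zero
  have e : x * y = algebraMap _ (RatFunc ℂ) (x.num * y.num)
      / algebraMap _ (RatFunc ℂ) (x.denom * y.denom) := by
    conv_lhs => rw [← x.num_div_denom, ← y.num_div_denom]
    simp only [map_mul]
    field_simp
  have ex := x.num_div_denom
  have ey := y.num_div_denom
  change ratDerivFun (x * y) = x * ratDerivFun y + y * ratDerivFun x
  rw [e, ratDerivFun_div _ _ (mul_ne_zero x.denom_ne_zero y.denom_ne_zero)]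
  simp only [ratDerivFun, map_add, map_mul, Polynomial.derivative_mul]
  generalize algebraMap _ (RatFunc ℂ) x.num = N at *
  generalize algebraMap _ (RatFunc ℂ) x.denom = D at *
  generalize algebraMap _ (RatFunc ℂ) y.num = N' at *
  generalize algebraMap _ (RatFunc ℂ) y.denom = D' at *
  clear e
  subst ex ey
  field_simp
  ring

/-- `ℂ[λ]_{(λ-c)}`: the ring of rational functions that are regular at `c`. -/
def regularAt (c : ℂ) : Subring (RatFunc ℂ) where
  carrier := {f | f.denom.eval c ≠ 0}
  mul_mem' {x y} hx hy h := by
    have := Polynomial.eval_eq_zero_of_dvd_of_eval_eq_zero (RatFunc.denom_mul_dvd x y) h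
    rw [Polynomial.eval_mul] at this
    exact (mul_ne_zero hx hy) this
  one_mem' := by simp
  add_mem' {x y} hx hy h := by
    have := Polynomial.eval_eq_zero_of_dvd_of_eval_eq_zero (RatFunc.denom_add_dvd x y) h
    rw [Polynomial.eval_mul] at this
    exact (mul_ne_zero hx hy) this
  zero_mem' := by simp
  neg_mem' {x} hx h := by
    have hd : (-x).denom ∣ x.denom := by
      rw [RatFunc.denom_dvd x.denom_ne_zero]
      exact ⟨-x.num, by rw [map_neg, neg_div, RatFunc.num_div_denom]⟩
    exact hx (Polynomial.eval_eq_zero_of_dvd_of_eval_eq_zero hd h)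

/-- The evaluation `f ↦ f(c)` on `ℂ[λ]_{(λ-c)}`. -/
def evalAt (c : ℂ) : regularAt c →+* ℂ where
  toFun f := RatFunc.eval (RingHom.id ℂ) c f.1
  map_one' := by simp
  map_zero' := by simp
  map_add' f g := RatFunc.eval_add _ _ f.2 g.2
  map_mul' f g := RatFunc.eval_mul _ _ f.2 g.2

/-! ## The differential-difference ring `𝓡_λ` -/

/-- `𝓡_λ = 𝓗_{ℂ(λ)}[X, ∂X, ∂²X, …]`; the indeterminate of index `i` is `∂_λ^i X`. -/
abbrev RLam := MvPolynomial ℕ (Hahn (RatFunc ℂ))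

/-- `e_λ = X`. -/
def eLam : RLam := MvPolynomial.X 0

/-- The additive map of `𝓡_λ` which applies `∂/∂λ` to each coefficient of a polynomial. -/
def coeffDeriv : RLam →+ RLam where
  toFun P := ∑ s ∈ P.support, MvPolynomial.monomial s (hahnDeriv ratDeriv (P.coeff s))
  map_zero' := by simp
  map_add' P Q := by
    have key : ∀ (F : RLam) (T : Finset (ℕ →₀ ℕ)), F.support ⊆ T →
        ∑ s ∈ F.support, MvPolynomial.monomial s (hahnDeriv ratDeriv (F.coeff s)) =
        ∑ s ∈ T, MvPolynomial.monomial s (hahnDeriv ratDeriv (F.coeff s)) := by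
      intro F T hT
      refine Finset.sum_subset hT fun s _ hs => ?_
      rw [MvPolynomial.notMem_support_iff.mp hs]
      simp
    classical
    rw [key (P + Q) (P.support ∪ Q.support) MvPolynomial.support_add,
      key P (P.support ∪ Q.support) Finset.subset_union_left,
      key Q (P.support ∪ Q.support) Finset.subset_union_right, ← Finset.sum_add_distrib]
    simp

theorem coeffDeriv_monomial (s : ℕ →₀ ℕ) (f : Hahn (RatFunc ℂ)) :
    coeffDeriv (MvPolynomial.monomial s f) =
      MvPolynomial.monomial s (hahnDeriv ratDeriv f) := by
  classical
  change ∑ t ∈ (MvPolynomial.monomial s f).support, MvPolynomial.monomial t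
    (hahnDeriv ratDeriv ((MvPolynomial.monomial s f).coeff t)) = _
  by_cases hf : f = 0
  · simp [hf]
  · rw [MvPolynomial.support_monomial, if_neg hf]
    simp

theorem coeffDeriv_mul (P Q : RLam) :
    coeffDeriv (P * Q) = P * coeffDeriv Q + Q * coeffDeriv P := by
  induction P using MvPolynomial.induction_on' with
  | add P₁ P₂ h₁ h₂ => rw [add_mul, map_add, h₁, h₂, map_add]; ring
  | monomial s f =>
    induction Q using MvPolynomial.induction_on' with
    | add Q₁ Q₂ h₁ h₂ => rw [mul_add, map_add, h₁, h₂, map_add]; ring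
    | monomial t g =>
      simp only [MvPolynomial.monomial_mul, coeffDeriv_monomial,
        hahnDeriv_mul ratDeriv ratDeriv_mul, map_add]
      rw [add_comm t s]

/-- The derivation `∂_λ` of `𝓡_λ`: it extends `∂/∂λ` on `𝓗_{ℂ(λ)}` and sends the
indeterminate `∂_λ^i X` to `∂_λ^{i+1} X`. -/
def dLam : RLam →+ RLam :=
  coeffDeriv + ((MvPolynomial.mkDerivation (Hahn (RatFunc ℂ))
    (fun i => (MvPolynomial.X (i + 1) : RLam)) : RLam →ₗ[Hahn (RatFunc ℂ)] RLam) : RLam →+ RLam)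

theorem dLam_mul (P Q : RLam) : dLam (P * Q) = P * dLam Q + Q * dLam P := by
  change coeffDeriv (P * Q) + MvPolynomial.mkDerivation (Hahn (RatFunc ℂ)) _ (P * Q) =
    P * (coeffDeriv Q + MvPolynomial.mkDerivation (Hahn (RatFunc ℂ)) _ Q) +
    Q * (coeffDeriv P + MvPolynomial.mkDerivation (Hahn (RatFunc ℂ)) _ P)
  rw [coeffDeriv_mul, Derivation.leibniz, smul_eq_mul, smul_eq_mul]
  ring

theorem dLam_C (f : Hahn (RatFunc ℂ)) :
    dLam (MvPolynomial.C f) = MvPolynomial.C (hahnDeriv ratDeriv f) := by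
  change coeffDeriv (MvPolynomial.monomial 0 f)
    + MvPolynomial.mkDerivation (Hahn (RatFunc ℂ)) _ (MvPolynomial.C f) = _
  rw [coeffDeriv_monomial, MvPolynomial.derivation_C, add_zero]
  rfl

theorem dLam_X (i : ℕ) : dLam (MvPolynomial.X i) = MvPolynomial.X (i + 1) := by
  change coeffDeriv (MvPolynomial.monomial _ 1)
    + MvPolynomial.mkDerivation (Hahn (RatFunc ℂ)) _ (MvPolynomial.X i) = _
  have h : hahnDeriv ratDeriv 1 = 0 := by
    simpa using hahnDeriv_mul ratDeriv ratDeriv_mul 1 1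
  rw [coeffDeriv_monomial, MvPolynomial.mkDerivation_X, h]
  simp

/-- The operator `φ_p` on `𝓡_λ`: it extends `φ_p` on `𝓗_{ℂ(λ)}` and
`φ_p(∂_λ^i X) = ∂_λ^i(λ X)`. -/
def phiLam {p : ℕ} (hp : 2 ≤ p) : RLam →+* RLam :=
  MvPolynomial.eval₂Hom (MvPolynomial.C.comp (mahler hp (RatFunc ℂ)))
    (fun i => dLam^[i] (MvPolynomial.C (HahnSeries.C RatFunc.X) * eLam))

/-- The inclusion of `𝓗 = 𝓗_ℂ` in `𝓡_λ`. -/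
def constLam : Hahn ℂ →+* RLam :=
  MvPolynomial.C.comp (hahnMap (RatFunc.C : ℂ →+* RatFunc ℂ))

/-! ## The ring of solutions and the evaluation at `λ = c` -/

/-- A difference ring extension `𝓡` of `𝓗`, with nonzero elements `ℓ_{c,i}` such that
`φ_p(ℓ_{c,i}) = c ℓ_{c,i} + ℓ_{c,i-1}` (where `ℓ_{c,-1} = 0`). -/
structure SolutionRing {p : ℕ} (hp : 2 ≤ p) (R : Type*) [CommRing R] [Algebra (Hahn ℂ) R] where
  /-- The automorphism `φ_p` of `𝓡`. -/
  phi : R ≃+* R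
  algebraMap_injective : Function.Injective (algebraMap (Hahn ℂ) R)
  phi_algebraMap : ∀ f : Hahn ℂ, phi (algebraMap (Hahn ℂ) R f) =
    algebraMap (Hahn ℂ) R (mahler hp ℂ f)
  /-- The elements `ℓ_{c,i}`. -/
  ell : ℂˣ → ℕ → R
  ell_ne_zero : ∀ c i, ell c i ≠ 0
  phi_ell_zero : ∀ c : ℂˣ, phi (ell c 0) = algebraMap (Hahn ℂ) R (HahnSeries.C (c : ℂ)) * ell c 0
  phi_ell_succ : ∀ (c : ℂˣ) (i : ℕ), phi (ell c (i + 1)) =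
    algebraMap (Hahn ℂ) R (HahnSeries.C (c : ℂ)) * ell c (i + 1) + ell c i

/-- The inclusion of `𝓗_{ℂ[λ]_{(λ-c)}}[X, ∂X, …]` in `𝓡_λ`. -/
def inclLam (c : ℂ) : MvPolynomial ℕ (Hahn (regularAt c)) →+* RLam :=
  MvPolynomial.map (hahnMap (regularAt c).subtype)

theorem inclLam_injective (c : ℂ) : Function.Injective (inclLam c) := by
  refine MvPolynomial.map_injective _ fun x y h => ?_
  ext γ
  exact congrArg (fun u : Hahn (RatFunc ℂ) => u.coeff γ) h

/-- The subring `𝓡_{λ,c} = 𝓗_{ℂ[λ]_{(λ-c)}}[X, ∂X, …]` of `𝓡_λ`. -/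
def RLamAt (c : ℂ) : Subring RLam where
  carrier := Set.range (inclLam c)
  mul_mem' := by rintro _ _ ⟨x, rfl⟩ ⟨y, rfl⟩; exact ⟨x * y, map_mul _ _ _⟩
  one_mem' := ⟨1, map_one _⟩
  add_mem' := by rintro _ _ ⟨x, rfl⟩ ⟨y, rfl⟩; exact ⟨x + y, map_add _ _ _⟩
  zero_mem' := ⟨0, map_zero _⟩
  neg_mem' := by rintro _ ⟨x, rfl⟩; exact ⟨-x, map_neg _ _⟩

/-- The identification of `𝓗_{ℂ[λ]_{(λ-c)}}[X, ∂X, …]` with `𝓡_{λ,c}`. -/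
def equivRLamAt (c : ℂ) : MvPolynomial ℕ (Hahn (regularAt c)) ≃+* RLamAt c :=
  RingEquiv.ofBijective ((inclLam c).codRestrict (RLamAt c) fun x => ⟨x, rfl⟩)
    ⟨fun _ _ h => inclLam_injective c (congrArg Subtype.val h),
      by rintro ⟨_, x, rfl⟩; exact ⟨x, rfl⟩⟩

/-- The ring morphism `ev_c : 𝓡_{λ,c} → 𝓡` with `ev_c(f(λ,z)) = f(c,z)` for
`f ∈ 𝓗_{ℂ[λ]_{(λ-c)}}` and `ev_c(∂_λ^i(e_λ) / i!) = ℓ_{c,i}`. -/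
def ev {p : ℕ} {hp : 2 ≤ p} {R : Type*} [CommRing R] [Algebra (Hahn ℂ) R]
    (S : SolutionRing hp R) (c : ℂˣ) : RLamAt (c : ℂ) →+* R :=
  (MvPolynomial.eval₂Hom ((algebraMap (Hahn ℂ) R).comp (hahnMap (evalAt (c : ℂ))))
      (fun i => (i.factorial : R) * S.ell c i)).comp
    (equivRLamAt (c : ℂ)).symm.toRingHom

/-! ## Mahler operators, Newton polygons, slopes and exponents -/

/-- A Mahler operator `L = a_n(z) φ_p^n + ⋯ + a_0(z)` with `a_i ∈ 𝓗` and `a_0 a_n ≠ 0`; here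
`n = order` and `a_i = coeff i` (the values of `coeff` beyond `order` play no role). -/
structure MahlerOperator where
  order : ℕ
  coeff : ℕ → Hahn ℂ
  coeff_zero_ne : coeff 0 ≠ 0
  coeff_order_ne : coeff order ≠ 0

namespace MahlerOperator

/-- The action `L(y) = ∑ a_i φ^i(y)` of `L` on a ring with an operator `φ` which receives `𝓗`. -/
def apply (L : MahlerOperator) {B : Type*} [CommRing B] (ι : Hahn ℂ →+* B) (φ : B →+* B)
    (y : B) : B :=
  ∑ i ∈ Finset.range (L.order + 1), ι (L.coeff i) * (⇑φ)^[i] y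

/-- The Newton polygon: the convex hull of the `(p^i, y)` with `y ≥ val_z(a_i)`. Here
`HahnSeries.order` is `val_z`; the indices with `a_i = 0`, for which `val_z(a_i) = +∞`,
contribute nothing. -/
def newtonPolygon (p : ℕ) (L : MahlerOperator) : Set (ℝ × ℝ) :=
  convexHull ℝ {P | ∃ i ≤ L.order, L.coeff i ≠ 0 ∧ P.1 = (p : ℝ) ^ i ∧
    (((L.coeff i).order : ℚ) : ℝ) ≤ P.2}

/-- `(p^i, val_z(a_i))` is a vertex of the Newton polygon. -/
def IsVertexIndex (p : ℕ) (L : MahlerOperator) (i : ℕ) : Prop :=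
  i ≤ L.order ∧ L.coeff i ≠ 0 ∧
    ((p : ℝ) ^ i, (((L.coeff i).order : ℚ) : ℝ)) ∈ (L.newtonPolygon p).extremePoints ℝ

/-- The indices `α_0 < α_1 < ⋯ < α_k` of the vertices, in increasing order. -/
def alpha (p : ℕ) (L : MahlerOperator) (j : ℕ) : ℕ := Nat.nth (L.IsVertexIndex p) j

/-- The number `k` of slopes; there are `k + 1` vertices. -/
def numSlopes (p : ℕ) (L : MahlerOperator) : ℕ := {i | L.IsVertexIndex p i}.ncard - 1

/-- The slope `μ_j` (for `1 ≤ j ≤ k`) of the vector `v_j - v_{j-1}`. -/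
def slope (p : ℕ) (L : MahlerOperator) (j : ℕ) : ℚ :=
  ((L.coeff (L.alpha p j)).order - (L.coeff (L.alpha p (j - 1))).order)
    / ((p : ℚ) ^ L.alpha p j - (p : ℚ) ^ L.alpha p (j - 1))

/-- The multiplicity `r_j = α_j - α_{j-1}` of the slope `μ_j` (for `1 ≤ j ≤ k`). -/
def slopeMult (p : ℕ) (L : MahlerOperator) (j : ℕ) : ℕ := L.alpha p j - L.alpha p (j - 1)

/-- `ν_j = (p-1) (p^{r_1+⋯+r_{j-1}} (μ_j-μ_{j-1}) + ⋯ + p^{r_1} (μ_2-μ_1) + μ_1)`. -/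
def nu (p : ℕ) (L : MahlerOperator) (j : ℕ) : ℚ :=
  ((p : ℚ) - 1) * (L.slope p 1 + ∑ i ∈ Finset.Icc 2 j,
    (p : ℚ) ^ (∑ l ∈ Finset.Icc 1 (i - 1), L.slopeMult p l) * (L.slope p i - L.slope p (i - 1)))

/-- `L^{[θ_μ(z)]} = ∑ z^{((p^i - 1)/(p - 1)) μ} a_i(z) φ_p^i`, where `θ_μ(z) = z^{μ/(p-1)}`. -/
def gauge (p : ℕ) (L : MahlerOperator) (μ : ℚ) : MahlerOperator where
  order := L.order
  coeff i := HahnSeries.single (((p : ℚ) ^ i - 1) / ((p : ℚ) - 1) * μ) 1 * L.coeff i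
  coeff_zero_ne := mul_ne_zero (HahnSeries.single_ne_zero one_ne_zero) L.coeff_zero_ne
  coeff_order_ne := mul_ne_zero (HahnSeries.single_ne_zero one_ne_zero) L.coeff_order_ne

/-- `val_z(L) = min (val_z(a_0), …, val_z(a_n))`, a rational number since `a_0 ≠ 0`. -/
def val (L : MahlerOperator) : ℚ :=
  ((Finset.range (L.order + 1)).inf fun i => (L.coeff i).orderTop).untopD 0

/-- The value at `z = 0` of `z^{-val_z(L)} ∑ a_i(z) X^i`. -/
def leadingPoly (L : MahlerOperator) : Polynomial ℂ :=
  ∑ i ∈ Finset.range (L.order + 1),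
    Polynomial.C ((HahnSeries.single (-L.val) 1 * L.coeff i).coeff 0) * Polynomial.X ^ i

/-- The characteristic polynomial `χ(μ_j, L; X)` attached to the slope `μ_j`. -/
def charPoly (p : ℕ) (L : MahlerOperator) (j : ℕ) : Polynomial ℂ :=
  (L.gauge p (-((p : ℚ) - 1) * L.slope p j)).leadingPoly

/-- `c ∈ ℂˣ` is an exponent attached to the slope `μ_j`. -/
def IsExponent (p : ℕ) (L : MahlerOperator) (j : ℕ) (c : ℂˣ) : Prop :=
  (L.charPoly p j).IsRoot (c : ℂ)

/-- The multiplicity `m_{c,j}` of `c` as an exponent attached to `μ_j` (`0` if it is not one). -/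
def expMult (p : ℕ) (L : MahlerOperator) (j : ℕ) (c : ℂˣ) : ℕ :=
  (L.charPoly p j).rootMultiplicity (c : ℂ)

/-- `s_{c,j} = m_{c,1} + ⋯ + m_{c,j-1}`. -/
def expSum (p : ℕ) (L : MahlerOperator) (j : ℕ) (c : ℂˣ) : ℕ :=
  ∑ i ∈ Finset.Icc 1 (j - 1), L.expMult p i c

/-- `g ∈ 𝓗_{ℂ(λ)}` satisfies
`L(g e_λ) = z^{val_z(a_0) - ν_j/(p-1)} (λ - c)^{s_{c,j} + m_{c,j}} e_λ`. -/
def FrobeniusEquation {p : ℕ} (hp : 2 ≤ p) (L : MahlerOperator) (j : ℕ) (c : ℂˣ)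
    (g : Hahn (RatFunc ℂ)) : Prop :=
  L.apply constLam (phiLam hp) (MvPolynomial.C g * eLam) =
    MvPolynomial.C
      (HahnSeries.single ((L.coeff 0).order - L.nu p j / ((p : ℚ) - 1))
        ((RatFunc.X - RatFunc.C (c : ℂ)) ^ (L.expSum p j c + L.expMult p j c))) * eLam

end MahlerOperator

end MahlerFrobenius

end

/-! Since φ_p^i(g e_λ) = λ^i φ_p^i(g) e_λ, the equation for g becomes Λ(g) = z^δ (λ-c)^N, where Λ(g)
= ∑ a_i λ^i φ_p^i(g) (`twist`), N = s_{c,j} + m_{c,j} and δ = val_z(a_0) - ν_j/(p-1). A leading term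
a z^γ is sent by Λ to P_γ(λ) a z^{T(γ)}, with T(γ) = min_i (val_z(a_i) + p^i γ) (`minVal`) and P_γ
the polynomial formed from the leading coefficients of the a_i reaching this minimum (`facePoly`). T
is an increasing bijection of ℚ and P_γ is never 0, so Λ is bijective (`bijective_twist`): g exists
and is unique.

Solving for the coefficient of z^γ divides by P_γ, which costs as many factors λ-c as the
multiplicity of c in P_γ. As c ≠ 0, a root at c requires two terms on the supporting line, so -γ is
a slope μ_i, and P_{-μ_i} is the characteristic polynomial χ_i (`exists_slope_eq_of_isRoot`,
`charPoly_eq_facePoly`). Moreover δ = T(-μ_j), so g starts no earlier than -μ_j and only the slopes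
μ_i with i ≤ j are met. The total loss is at most m_{c,1} + ⋯ + m_{c,j} = N, which the factor
(λ-c)^N pays for: the coefficients of g are regular at c (`coeff_mem_powIdeal`).

Finally ∂_λ commutes with L. For k = s_{c,j} + m < N, L(∂_λ^k(g e_λ)) is the k-th derivative of a
multiple of (λ-c)^N, hence still divisible by λ-c. The morphism ev_c intertwines the two operators
φ_p and kills λ-c, so the value at c is a solution (`apply_ev`, `dLam_iterate_pow_mul`). -/

namespace MahlerFrobenius

/-! ## Operators on Hahn series which are determined by their leading terms -/

/-- The additive map `Λ` sends a series with leading term `a z^γ` to a series with leading term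
`P(γ) a z^{T(γ)}`. -/
structure HasLeadingTerms {K : Type*} [Field K] (Λ : Hahn K →+ Hahn K) (T : ℚ → ℚ) (P : ℚ → K) :
    Prop where
  coeff_lt : ∀ g γ, (∀ γ' < γ, g.coeff γ' = 0) → ∀ δ < T γ, (Λ g).coeff δ = 0
  coeff_eq : ∀ g γ, (∀ γ' < γ, g.coeff γ' = 0) → (Λ g).coeff (T γ) = P γ * g.coeff γ

namespace HasLeadingTerms

variable {K : Type*} [Field K] {Λ : Hahn K →+ Hahn K} {T : ℚ → ℚ} {P : ℚ → K}

theorem injective (h : HasLeadingTerms Λ T P) (hP : ∀ γ, P γ ≠ 0) : Function.Injective Λ := by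
  rw [injective_iff_map_eq_zero]
  intro g hg
  by_contra hne
  have h1 := h.coeff_eq g g.order fun γ' h' => HahnSeries.coeff_eq_zero_of_lt_order h'
  rw [hg, HahnSeries.coeff_zero, eq_comm, mul_eq_zero] at h1
  exact h1.elim (hP _) fun h2 => hne (HahnSeries.coeff_order_eq_zero.mp h2)

/-- `g'` extends `g`: the two series agree up to each exponent of `g`. -/
def Extends (g g' : Hahn K) : Prop :=
  ∀ γ, g.coeff γ ≠ 0 → ∀ γ' ≤ γ, g'.coeff γ' = g.coeff γ'

theorem Extends.trans {g g' g'' : Hahn K} (h : Extends g g') (h' : Extends g' g'') :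
    Extends g g'' := by
  intro γ hγ γ' hle
  rw [h' γ (by rwa [h γ hγ γ le_rfl]) γ' hle, h γ hγ γ' hle]

/-- The union of the chain: members that are nonzero at an exponent agree there. Its support is well
founded because the part below one of its exponents lies in the support of a single member. -/
theorem exists_extends_of_isChain (c : Set (Hahn K)) (hc : IsChain Extends c) :
    ∃ u : Hahn K, (∀ g ∈ c, Extends g u) ∧ ∀ γ, u.coeff γ ≠ 0 → ∃ g ∈ c, g.coeff γ ≠ 0 := by
  classical
  have agree : ∀ g ∈ c, ∀ g' ∈ c, ∀ γ, g.coeff γ ≠ 0 → ∀ γ' ≤ γ, g'.coeff γ' ≠ 0 →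
      g'.coeff γ' = g.coeff γ' := by
    intro g hg g' hg' γ hγ γ' hle hγ'
    rcases eq_or_ne g g' with rfl | hne
    · rfl
    rcases hc hg hg' hne with h | h
    · exact h γ hγ γ' hle
    · exact (h γ' hγ' γ' le_rfl).symm
  let f : ℚ → K := fun γ => if h : ∃ g ∈ c, g.coeff γ ≠ 0 then h.choose.coeff γ else 0
  have hf : ∀ g ∈ c, ∀ γ, g.coeff γ ≠ 0 → ∀ γ' ≤ γ, f γ' = g.coeff γ' := by
    intro g hg γ hγ γ' hle
    by_cases h : ∃ g ∈ c, g.coeff γ' ≠ 0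
    · simp only [f, dif_pos h]
      exact agree g hg _ h.choose_spec.1 γ hγ γ' hle h.choose_spec.2
    · simp only [f, dif_neg h]
      by_contra h0
      exact h ⟨g, hg, fun h1 => h0 h1.symm⟩
  have hs : ∀ γ, f γ ≠ 0 → ∃ g ∈ c, g.coeff γ ≠ 0 := by
    intro γ hγ
    by_contra h
    exact hγ (by simp only [f, dif_neg h])
  have hwf : (Function.support f).IsWF := by
    rw [Set.isWF_iff_no_descending_seq]
    intro s hs' hmem
    obtain ⟨g, hg, hg0⟩ := hs (s 0) (hmem 0)
    refine Set.isWF_iff_no_descending_seq.mp g.isWF_support s hs' fun n => ?_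
    have := hf g hg (s 0) hg0 (s n) (hs'.antitone (Nat.zero_le n))
    rw [HahnSeries.mem_support, ← this]
    exact hmem n
  exact ⟨⟨f, hwf.isPWO⟩, fun g hg γ hγ γ' hle => hf g hg γ hγ γ' hle, hs⟩

/-- An operator with leading terms whose exponents and coefficients are invertible is onto. -/
theorem surjective (h : HasLeadingTerms Λ T P) (hP : ∀ γ, P γ ≠ 0) (hT : StrictMono T)
    (hTs : Function.Surjective T) : Function.Surjective Λ := by
  classical
  intro y
  -- Partial solutions: the residue vanishes up to the image under T of every exponent of g. Zorn's
  -- lemma for `Extends` replaces a transfinite construction term by term.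
  let Good : Hahn K → Prop := fun g => ∀ γ, g.coeff γ ≠ 0 → ∀ δ ≤ T γ, (y - Λ g).coeff δ = 0
  obtain ⟨⟨g, hg⟩, hmax⟩ := exists_maximal_of_chains_bounded
    (α := {g : Hahn K // Good g}) (r := fun g g' => Extends g.1 g'.1) (by
      intro c hc
      obtain ⟨u, hu, hu'⟩ := exists_extends_of_isChain (Subtype.val '' c) (by
        rintro _ ⟨g, hg, rfl⟩ _ ⟨g', hg', rfl⟩ hne
        exact hc hg hg' fun h => hne (by rw [h]))
      refine ⟨⟨u, ?_⟩, fun a ha => hu a.1 ⟨a, ha, rfl⟩⟩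
      intro γ hγ δ hδ
      obtain ⟨_, ⟨g, hgc, rfl⟩, hg0⟩ := hu' γ hγ
      have hug := hu g.1 ⟨g, hgc, rfl⟩ γ hg0
      -- Up to γ the union coincides with a member g of the chain, so Λ(u - g) vanishes up to and
      -- including T(γ).
      have hz : ∀ γ' ≤ γ, (u - g.1).coeff γ' = 0 := fun γ' h' => by
        rw [HahnSeries.coeff_sub, hug γ' h', sub_self]
      have e : y - Λ u = (y - Λ g.1) - Λ (u - g.1) := by rw [map_sub]; abel
      rw [e, HahnSeries.coeff_sub, g.2 γ hg0 δ hδ, zero_sub, neg_eq_zero]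
      rcases hδ.lt_or_eq with hlt | rfl
      · exact h.coeff_lt _ γ (fun γ' h' => hz γ' h'.le) δ hlt
      · rw [h.coeff_eq _ γ (fun γ' h' => hz γ' h'.le), hz γ le_rfl, mul_zero])
    (fun h1 h2 => h1.trans h2)
  refine ⟨g, ?_⟩
  by_contra hne
  have hne' : y - Λ g ≠ 0 := fun h0 => hne (sub_eq_zero.mp h0).symm
  -- If the residue is nonzero, its leading term is the leading term of Λ(a z^γ) for suitable γ and
  -- a. By `Good`, γ lies beyond all exponents of g, so adding a z^γ extends g.
  obtain ⟨γ, hγ⟩ := hTs (y - Λ g).order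
  have hlead : (y - Λ g).coeff (T γ) ≠ 0 := by
    rw [hγ]; exact fun h0 => hne' (HahnSeries.coeff_order_eq_zero.mp h0)
  have hlt : ∀ γ', g.coeff γ' ≠ 0 → γ' < γ := by
    intro γ' h'
    by_contra hle
    exact hlead (hg γ' h' _ (hT.monotone (not_lt.mp hle)))
  have hgγ : g.coeff γ = 0 := by
    by_contra h'
    exact lt_irrefl _ (hlt γ h')
  set a := (P γ)⁻¹ * (y - Λ g).coeff (T γ) with ha
  have ha0 : a ≠ 0 := mul_ne_zero (inv_ne_zero (hP γ)) hlead
  have hs : ∀ γ' < γ, (HahnSeries.single γ a).coeff γ' = 0 := fun γ' h' =>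
    HahnSeries.coeff_single_of_ne h'.ne
  have hres : ∀ δ ≤ T γ, (y - Λ (g + HahnSeries.single γ a)).coeff δ = 0 := by
    intro δ hδ
    rw [map_add, ← sub_sub, HahnSeries.coeff_sub]
    rcases hδ.lt_or_eq with hδ | rfl
    · rw [h.coeff_lt _ γ hs δ hδ, HahnSeries.coeff_eq_zero_of_lt_order (hγ ▸ hδ), sub_zero]
    · rw [h.coeff_eq _ γ hs, HahnSeries.coeff_single_same, ha, mul_inv_cancel_left₀ (hP γ),
        sub_self]
  have hcoeff : ∀ γ' < γ, (g + HahnSeries.single γ a).coeff γ' = g.coeff γ' := fun γ' h' => by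
    rw [HahnSeries.coeff_add, hs γ' h', add_zero]
  have hgood : Good (g + HahnSeries.single γ a) := by
    intro γ' h' δ hδ
    refine hres δ (hδ.trans (hT.monotone ?_))
    by_contra hlt'
    rw [not_le] at hlt'
    rw [HahnSeries.coeff_add, HahnSeries.coeff_single_of_ne hlt'.ne', add_zero] at h'
    exact lt_asymm hlt' (hlt γ' h')
  have hext : Extends g (g + HahnSeries.single γ a) := fun γ₁ h₁ γ' h' =>
    hcoeff γ' (h'.trans_lt (hlt γ₁ h₁))
  have hgγ' : (g + HahnSeries.single γ a).coeff γ = a := by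
    rw [HahnSeries.coeff_add, hgγ, zero_add, HahnSeries.coeff_single_same]
  -- Maximality would make g agree at γ with its extension, whose coefficient there is a ≠ 0.
  have := hmax ⟨_, hgood⟩ hext γ (by rw [hgγ']; exact ha0) γ le_rfl
  rw [hgγ, hgγ'] at this
  exact ha0 this.symm

end HasLeadingTerms

/-! ## The operator `∑ a_i λ^i φ_p^i` on `𝓗_{ℂ(λ)}` -/

theorem mahler_iterate_coeff {p : ℕ} (hp : 2 ≤ p) {A : Type*} [CommRing A] (i : ℕ) (f : Hahn A)
    (γ : ℚ) : ((⇑(mahler hp A))^[i] f).coeff γ = f.coeff (γ / (p : ℚ) ^ i) := by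
  have hp0 : (p : ℚ) ≠ 0 := by exact_mod_cast (by omega : p ≠ 0)
  induction i generalizing γ with
  | zero => simp
  | succ i ih =>
    rw [Function.iterate_succ_apply']
    conv_lhs => rw [← mul_div_cancel₀ γ hp0, mahler_coeff, ih]
    rw [div_div, pow_succ']

theorem coeff_mul_of_lt {A : Type*} [CommRing A] {x y : Hahn A} {v w δ : ℚ}
    (hx : ∀ s < v, x.coeff s = 0) (hy : ∀ t < w, y.coeff t = 0) (hδ : δ < v + w) :
    (x * y).coeff δ = 0 := by
  rw [HahnSeries.coeff_mul]
  refine Finset.sum_eq_zero fun q hq => ?_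
  rw [Finset.mem_antidiagonal] at hq
  rcases lt_or_ge q.1 v with h | h
  · rw [hx _ h, zero_mul]
  · rw [hy q.2 (by linarith [hq.2.2]), mul_zero]

theorem coeff_mul_add {A : Type*} [CommRing A] {x y : Hahn A} {v w : ℚ}
    (hx : ∀ s < v, x.coeff s = 0) (hy : ∀ t < w, y.coeff t = 0) :
    (x * y).coeff (v + w) = x.coeff v * y.coeff w := by
  rw [HahnSeries.coeff_mul, Finset.sum_eq_single (v, w)]
  · intro q hq hne
    rw [Finset.mem_antidiagonal] at hq
    rcases lt_trichotomy q.1 v with h | h | h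
    · rw [hx _ h, zero_mul]
    · exact absurd (Prod.ext h (by linarith [hq.2.2] : q.2 = w)) hne
    · rw [hy q.2 (by linarith [hq.2.2]), mul_zero]
  · intro hq
    rw [Finset.mem_antidiagonal] at hq
    by_cases h1 : x.coeff v = 0
    · rw [h1, zero_mul]
    · by_cases h2 : y.coeff w = 0
      · rw [h2, mul_zero]
      · exact absurd ⟨h1, h2, rfl⟩ hq

namespace MahlerOperator

variable (p : ℕ) (L : MahlerOperator)

open Classical in
/-- The indices of the nonzero coefficients of `L`. -/
noncomputable def terms : Finset ℕ := (Finset.range (L.order + 1)).filter fun i => L.coeff i ≠ 0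

variable {L} in
theorem mem_terms {i : ℕ} : i ∈ L.terms ↔ i ≤ L.order ∧ L.coeff i ≠ 0 := by
  simp [terms]

theorem zero_mem_terms : 0 ∈ L.terms := mem_terms.mpr ⟨Nat.zero_le _, L.coeff_zero_ne⟩

theorem terms_nonempty : L.terms.Nonempty := ⟨0, L.zero_mem_terms⟩

/-- `min_i (val_z(a_i) + p^i γ)`, the valuation of `L(f)` for a general `f` of valuation `γ`. -/
noncomputable def minVal (γ : ℚ) : ℚ :=
  L.terms.inf' L.terms_nonempty fun i => (L.coeff i).order + (p : ℚ) ^ i * γ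

variable {L} in
theorem minVal_le {i : ℕ} (hi : i ∈ L.terms) (γ : ℚ) :
    L.minVal p γ ≤ (L.coeff i).order + (p : ℚ) ^ i * γ :=
  Finset.inf'_le _ hi

theorem exists_minVal_eq (γ : ℚ) :
    ∃ i ∈ L.terms, L.minVal p γ = (L.coeff i).order + (p : ℚ) ^ i * γ :=
  Finset.exists_mem_eq_inf' _ _

variable {p} (hp : 2 ≤ p)
include hp

theorem strictMono_minVal : StrictMono (L.minVal p) := by
  intro γ γ' h
  obtain ⟨i, hi, hi'⟩ := L.exists_minVal_eq p γ'
  have hp0 : (0 : ℚ) < (p : ℚ) ^ i := pow_pos (by exact_mod_cast (by omega : 0 < p)) i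
  have := mul_lt_mul_of_pos_left h hp0
  linarith [minVal_le p hi γ]

/-- A minimum of increasing affine functions is inverted by the maximum of their inverses; these are
defined on ℚ because it is divisible by p. -/
theorem surjective_minVal : Function.Surjective (L.minVal p) := by
  intro δ
  have hp0 : ∀ i, (0 : ℚ) < (p : ℚ) ^ i := pow_pos (by exact_mod_cast (by omega : 0 < p))
  obtain ⟨i, hi, hi'⟩ := Finset.exists_mem_eq_sup' L.terms_nonempty
    fun i => (δ - (L.coeff i).order) / (p : ℚ) ^ i
  refine ⟨L.terms.sup' L.terms_nonempty fun i => (δ - (L.coeff i).order) / (p : ℚ) ^ i,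
    le_antisymm ((minVal_le p hi _).trans_eq ?_) ?_⟩
  · rw [hi', mul_div_cancel₀ _ (hp0 i).ne']
    ring
  · refine Finset.le_inf' _ _ fun l hl => ?_
    have := Finset.le_sup' (fun i => (δ - (L.coeff i).order) / (p : ℚ) ^ i) hl
    rw [div_le_iff₀ (hp0 l)] at this
    linarith

omit hp in
theorem coeff_eq_zero_of_lt_minVal {i : ℕ} (hi : i ≤ L.order) (γ : ℚ) {s : ℚ}
    (hs : s < L.minVal p γ - (p : ℚ) ^ i * γ) : (L.coeff i).coeff s = 0 := by
  by_cases h0 : L.coeff i = 0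
  · rw [h0, HahnSeries.coeff_zero]
  · refine HahnSeries.coeff_eq_zero_of_lt_order ?_
    linarith [minVal_le p (mem_terms.mpr ⟨hi, h0⟩) γ]

variable (p) in
omit hp in
/-- The polynomial `∑ lc(a_i) X^i` over the `i` for which `val_z(a_i) + p^i γ` is minimal. -/
noncomputable def facePoly (γ : ℚ) : Polynomial ℂ :=
  ∑ i ∈ Finset.range (L.order + 1),
    Polynomial.C ((L.coeff i).coeff (L.minVal p γ - (p : ℚ) ^ i * γ)) * Polynomial.X ^ i

omit hp in
theorem facePoly_coeff {i : ℕ} (hi : i ≤ L.order) (γ : ℚ) :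
    (L.facePoly p γ).coeff i = (L.coeff i).coeff (L.minVal p γ - (p : ℚ) ^ i * γ) := by
  simp [facePoly, Polynomial.coeff_C_mul, Polynomial.coeff_X_pow, hi]

omit hp in
theorem facePoly_ne_zero (γ : ℚ) : L.facePoly p γ ≠ 0 := by
  obtain ⟨i, hi, hi'⟩ := L.exists_minVal_eq p γ
  intro h
  have := L.facePoly_coeff (p := p) (mem_terms.mp hi).1 γ
  rw [h, hi', add_sub_cancel_right, Polynomial.coeff_zero, eq_comm,
    HahnSeries.coeff_order_eq_zero] at this
  exact (mem_terms.mp hi).2 this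

/-- The operator `g ↦ ∑ a_i λ^i φ_p^i(g)`, which satisfies `L(g e_λ) = Λ(g) e_λ`. -/
noncomputable def twist : Hahn (RatFunc ℂ) →+ Hahn (RatFunc ℂ) where
  toFun g := ∑ i ∈ Finset.range (L.order + 1), (hahnMap RatFunc.C (L.coeff i) *
    HahnSeries.C (RatFunc.X ^ i)) * (⇑(mahler hp (RatFunc ℂ)))^[i] g
  map_zero' := by simp [iterate_map_zero]
  map_add' x y := by simp [iterate_map_add, mul_add, Finset.sum_add_distrib]

theorem twist_apply (g : Hahn (RatFunc ℂ)) :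
    L.twist hp g = ∑ i ∈ Finset.range (L.order + 1), (hahnMap RatFunc.C (L.coeff i) *
      HahnSeries.C (RatFunc.X ^ i)) * (⇑(mahler hp (RatFunc ℂ)))^[i] g := rfl

omit hp in
theorem coeff_twisted (i : ℕ) (s : ℚ) :
    (hahnMap RatFunc.C (L.coeff i) * HahnSeries.C (RatFunc.X ^ i : RatFunc ℂ)).coeff s =
      RatFunc.C ((L.coeff i).coeff s) * RatFunc.X ^ i := by
  rw [mul_comm, HahnSeries.C_apply, HahnSeries.coeff_single_mul, sub_zero, hahnMap_coeff, mul_comm]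

/-- The i-th term of Λ starts at or after T(γ), and reaches it only when i realizes the minimum.
Distinct i carry distinct powers of λ, so these contributions assemble into `facePoly` without
cancelling. -/
theorem hasLeadingTerms_twist : HasLeadingTerms (L.twist hp) (L.minVal p)
    (fun γ => algebraMap _ (RatFunc ℂ) (L.facePoly p γ)) := by
  have hp0 : ∀ i, (0 : ℚ) < (p : ℚ) ^ i := pow_pos (by exact_mod_cast (by omega : 0 < p))
  have h1 : ∀ γ, ∀ i ∈ Finset.range (L.order + 1), ∀ s < L.minVal p γ - (p : ℚ) ^ i * γ,
      (hahnMap RatFunc.C (L.coeff i) * HahnSeries.C (RatFunc.X ^ i : RatFunc ℂ)).coeff s = 0 := by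
    intro γ i hi s hs
    rw [coeff_twisted, L.coeff_eq_zero_of_lt_minVal (Nat.lt_succ_iff.mp (Finset.mem_range.mp hi))
      γ hs, map_zero, zero_mul]
  have h2 : ∀ (g : Hahn (RatFunc ℂ)) γ, (∀ γ' < γ, g.coeff γ' = 0) → ∀ i,
      ∀ t < (p : ℚ) ^ i * γ, ((⇑(mahler hp (RatFunc ℂ)))^[i] g).coeff t = 0 := by
    intro g γ hg i t ht
    rw [mahler_iterate_coeff]
    refine hg _ ?_
    rw [div_lt_iff₀ (hp0 i)]
    linarith
  refine ⟨fun g γ hg δ hδ => ?_, fun g γ hg => ?_⟩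
  · rw [twist_apply, HahnSeries.coeff_sum]
    exact Finset.sum_eq_zero fun i hi =>
      coeff_mul_of_lt (h1 γ i hi) (h2 g γ hg i) (by linarith)
  · rw [twist_apply, HahnSeries.coeff_sum, facePoly, map_sum, Finset.sum_mul]
    refine Finset.sum_congr rfl fun i hi => ?_
    have := coeff_mul_add (h1 γ i hi) (h2 g γ hg i)
    rw [sub_add_cancel] at this
    rw [this, coeff_twisted, mahler_iterate_coeff, mul_div_cancel_left₀ _ (hp0 i).ne']
    simp

theorem bijective_twist : Function.Bijective (L.twist hp) := by
  have hP : ∀ γ, algebraMap _ (RatFunc ℂ) (L.facePoly p γ) ≠ 0 := fun γ =>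
    RatFunc.algebraMap_ne_zero (L.facePoly_ne_zero γ)
  exact ⟨(L.hasLeadingTerms_twist hp).injective hP, (L.hasLeadingTerms_twist hp).surjective hP
    (L.strictMono_minVal hp) (L.surjective_minVal hp)⟩

end MahlerOperator

/-! ## Divisibility by powers of `λ - c` in `ℂ[λ]_{(λ-c)}` -/

theorem algebraMap_mem_regularAt (c : ℂ) (q : Polynomial ℂ) :
    algebraMap _ (RatFunc ℂ) q ∈ regularAt c := by
  change (algebraMap _ (RatFunc ℂ) q).denom.eval c ≠ 0
  rw [RatFunc.denom_algebraMap]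
  simp

theorem inv_algebraMap_mem_regularAt {c : ℂ} {q : Polynomial ℂ} (hq : q.eval c ≠ 0) :
    (algebraMap _ (RatFunc ℂ) q)⁻¹ ∈ regularAt c := by
  have hq0 : q ≠ 0 := fun h => hq (by rw [h, Polynomial.eval_zero])
  have hd := RatFunc.denom_div_dvd (1 : Polynomial ℂ) q
  rw [map_one, one_div] at hd
  exact fun h => hq (Polynomial.eval_eq_zero_of_dvd_of_eval_eq_zero hd h)

/-- The fractional ideal of the rational functions which are `(λ - c)^k` times a function regular
at `c`. -/
noncomputable def powIdeal (c : ℂ) (k : ℕ) : Submodule (regularAt c) (RatFunc ℂ) :=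
  Submodule.span (regularAt c) {(RatFunc.X - RatFunc.C c) ^ k}

theorem mem_powIdeal {c : ℂ} {k : ℕ} {f : RatFunc ℂ} :
    f ∈ powIdeal c k ↔ ∃ u ∈ regularAt c, u * (RatFunc.X - RatFunc.C c) ^ k = f := by
  rw [powIdeal, Submodule.mem_span_singleton]
  exact ⟨fun ⟨u, h⟩ => ⟨u.1, u.2, h⟩, fun ⟨u, hu, h⟩ => ⟨⟨u, hu⟩, h⟩⟩

theorem X_sub_C_eq_algebraMap (c : ℂ) : (RatFunc.X - RatFunc.C c : RatFunc ℂ) =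
    algebraMap _ (RatFunc ℂ) (Polynomial.X - Polynomial.C c) := by
  simp

theorem X_sub_C_mem_regularAt (c : ℂ) : (RatFunc.X - RatFunc.C c : RatFunc ℂ) ∈ regularAt c := by
  rw [X_sub_C_eq_algebraMap]
  exact algebraMap_mem_regularAt _ _

theorem powIdeal_anti (c : ℂ) {k l : ℕ} (h : k ≤ l) : powIdeal c l ≤ powIdeal c k := by
  intro f hf
  obtain ⟨u, hu, rfl⟩ := mem_powIdeal.mp hf
  refine mem_powIdeal.mpr ⟨u * (RatFunc.X - RatFunc.C c) ^ (l - k),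
    mul_mem hu (pow_mem (X_sub_C_mem_regularAt c) _), ?_⟩
  rw [mul_assoc, ← pow_add, Nat.sub_add_cancel h]

/-- The cofactor of (λ-c)^r in q, where r is the multiplicity of the root c, is a unit of the local
ring. Dividing by q therefore costs r factors λ-c. -/
theorem mem_powIdeal_of_mul_mem {c : ℂ} {k : ℕ} {q : Polynomial ℂ} (hq : q ≠ 0) {f : RatFunc ℂ}
    (hk : q.rootMultiplicity c ≤ k) (hf : algebraMap _ (RatFunc ℂ) q * f ∈ powIdeal c k) :
    f ∈ powIdeal c (k - q.rootMultiplicity c) := by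
  obtain ⟨u, hu, he⟩ := mem_powIdeal.mp hf
  obtain ⟨q', hq', hd⟩ := Polynomial.exists_eq_pow_rootMultiplicity_mul_and_not_dvd q hq c
  rw [Polynomial.dvd_iff_isRoot, Polynomial.IsRoot.def] at hd
  refine mem_powIdeal.mpr ⟨u * (algebraMap _ (RatFunc ℂ) q')⁻¹,
    mul_mem hu (inv_algebraMap_mem_regularAt hd), ?_⟩
  have h1 : algebraMap _ (RatFunc ℂ) q' ≠ 0 := RatFunc.algebraMap_ne_zero fun h =>
    hd (by rw [h, Polynomial.eval_zero])
  have h2 : (RatFunc.X - RatFunc.C c : RatFunc ℂ) ≠ 0 := by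
    rw [X_sub_C_eq_algebraMap]
    exact RatFunc.algebraMap_ne_zero (Polynomial.X_sub_C_ne_zero c)
  set r := q.rootMultiplicity c
  obtain ⟨l, rfl⟩ := Nat.exists_eq_add_of_le hk
  rw [hq', map_mul, map_pow, ← X_sub_C_eq_algebraMap, pow_add] at he
  have h3 : u * (RatFunc.X - RatFunc.C c) ^ l = algebraMap _ (RatFunc ℂ) q' * f :=
    mul_left_cancel₀ (pow_ne_zero r h2) (by linear_combination he)
  rw [Nat.add_sub_cancel_left, mul_right_comm, h3]
  field_simp

/-- The coefficients of Λ are polynomials in λ, hence regular at c, and φ_p only moves exponents. -/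
theorem MahlerOperator.twist_coeff_mem {p : ℕ} (hp : 2 ≤ p) (L : MahlerOperator) {c : ℂ}
    (D : Submodule (regularAt c) (RatFunc ℂ)) {g : Hahn (RatFunc ℂ)} (hg : ∀ γ, g.coeff γ ∈ D)
    (δ : ℚ) : (L.twist hp g).coeff δ ∈ D := by
  rw [twist_apply, HahnSeries.coeff_sum]
  refine sum_mem fun i _ => ?_
  rw [HahnSeries.coeff_mul]
  refine sum_mem fun q _ => ?_
  rw [coeff_twisted, mahler_iterate_coeff]
  have h : RatFunc.C ((L.coeff i).coeff q.1) * RatFunc.X ^ i ∈ regularAt c := by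
    have := algebraMap_mem_regularAt c
      (Polynomial.C ((L.coeff i).coeff q.1) * Polynomial.X ^ i)
    simpa using this
  exact D.smul_mem ⟨_, h⟩ (hg _)

/-! ## Newton polygons -/

/-- A strict minimum of a linear form on A remains strict on the convex hull, because {x} together
with an open half-space having x on its boundary is convex. -/
theorem mem_extremePoints_convexHull {E : Type*} [AddCommGroup E] [Module ℝ E] {A : Set E} {x : E}
    (hx : x ∈ A) (f : E →ₗ[ℝ] ℝ) (hf : ∀ y ∈ A, y ≠ x → f x < f y) :
    x ∈ (convexHull ℝ A).extremePoints ℝ := by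
  have hconv : Convex ℝ {y | y ≠ x → f x < f y} := by
    intro y hy z hz a b ha hb hab hne
    have e1 : f (a • y + b • z) = a * f y + b * f z := by simp
    have hle : ∀ w, (w ≠ x → f x < f w) → f x ≤ f w := fun w hw => by
      by_cases h : w = x
      · rw [h]
      · exact (hw h).le
    have e2 : f x = a * f x + b * f x := by rw [← add_mul, hab, one_mul]
    rw [e1, e2]
    have ha' := mul_le_mul_of_nonneg_left (hle y hy) ha
    have hb' := mul_le_mul_of_nonneg_left (hle z hz) hb
    by_contra hlt
    rw [not_lt] at hlt
    apply hne
    have hy' : a = 0 ∨ y = x := by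
      by_contra! h
      have := mul_lt_mul_of_pos_left (hy h.2) (lt_of_le_of_ne ha h.1.symm)
      linarith
    have hz' : b = 0 ∨ z = x := by
      by_contra! h
      have := mul_lt_mul_of_pos_left (hz h.2) (lt_of_le_of_ne hb h.1.symm)
      linarith
    have e3 : a • y = a • x := by rcases hy' with h | h <;> simp [h]
    have e4 : b • z = b • x := by rcases hz' with h | h <;> simp [h]
    rw [e3, e4, ← add_smul, hab, one_smul]
  have hsub : ∀ y ∈ convexHull ℝ A, y ≠ x → f x < f y := convexHull_min hf hconv
  refine mem_extremePoints_iff_left.mpr ⟨subset_convexHull ℝ A hx, ?_⟩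
  rintro y hy z hz ⟨a, b, ha, hb, hab, rfl⟩
  by_contra hne
  set x := a • y + b • z with hx'
  have h1 := mul_lt_mul_of_pos_left (hsub y hy hne) ha
  have h2 : f x ≤ f z := by
    by_cases h : z = x
    · rw [h]
    · exact (hsub z hz h).le
  have h3 := mul_le_mul_of_nonneg_left h2 hb.le
  have e1 : f x = a * f y + b * f z := by simp [hx']
  have e2 : f x = a * f x + b * f x := by rw [← add_mul, hab, one_mul]
  linarith

namespace MahlerOperator

variable {p : ℕ} (hp : 2 ≤ p) (L : MahlerOperator)

theorem pow_lt_pow_of_two_le (hp : 2 ≤ p) {i l : ℕ} (h : i < l) : (p : ℚ) ^ i < (p : ℚ) ^ l :=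
  pow_lt_pow_right₀ (by exact_mod_cast (by omega : 1 < p)) h

include hp

/-- The vertices are the points at which the slopes strictly increase. -/
theorem isVertexIndex_iff {i : ℕ} : L.IsVertexIndex p i ↔ i ∈ L.terms ∧
    ∀ k ∈ L.terms, ∀ l ∈ L.terms, k < i → i < l →
      ((L.coeff i).order - (L.coeff k).order) * ((p : ℚ) ^ l - (p : ℚ) ^ i) <
        ((L.coeff l).order - (L.coeff i).order) * ((p : ℚ) ^ i - (p : ℚ) ^ k) := by
  constructor
  · rintro ⟨hi, hi0, hext⟩
    refine ⟨mem_terms.mpr ⟨hi, hi0⟩, fun k hk l hl hki hil => ?_⟩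
    by_contra! hle
    have hki' : (p : ℝ) ^ k < (p : ℝ) ^ i := by
      exact_mod_cast pow_lt_pow_of_two_le hp hki
    have hil' : (p : ℝ) ^ i < (p : ℝ) ^ l := by
      exact_mod_cast pow_lt_pow_of_two_le hp hil
    have hle' : (((L.coeff l).order : ℝ) - (L.coeff i).order) * ((p : ℝ) ^ i - (p : ℝ) ^ k) ≤
        (((L.coeff i).order : ℝ) - (L.coeff k).order) * ((p : ℝ) ^ l - (p : ℝ) ^ i) := by
      exact_mod_cast hle
    generalize hka : (p : ℝ) ^ k = a at *
    generalize hlb : (p : ℝ) ^ l = b at *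
    set x := (p : ℝ) ^ i with hx
    -- The height of the point i above the chord from k to l. Raised by e, both ends of the chord
    -- stay in the polygon, and the point i lies in the open segment between them.
    set e := ((L.coeff i).order : ℝ) - ((b - x) / (b - a) * (L.coeff k).order
      + (x - a) / (b - a) * (L.coeff l).order) with he
    have hba : 0 < b - a := by linarith
    have he0 : 0 ≤ e := by
      have : e = ((((L.coeff i).order : ℝ) - (L.coeff k).order) * (b - x)
        - (((L.coeff l).order : ℝ) - (L.coeff i).order) * (x - a)) / (b - a) := by
        rw [he]; field_simp; ring
      rw [this]
      exact div_nonneg (by linarith) hba.le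
    have hk' := mem_terms.mp hk
    have hl' := mem_terms.mp hl
    have h1 : ((a, ((L.coeff k).order : ℝ) + e) : ℝ × ℝ) ∈ L.newtonPolygon p :=
      subset_convexHull ℝ _ ⟨k, hk'.1, hk'.2, hka.symm, by simpa using he0⟩
    have h2 : ((b, ((L.coeff l).order : ℝ) + e) : ℝ × ℝ) ∈ L.newtonPolygon p :=
      subset_convexHull ℝ _ ⟨l, hl'.1, hl'.2, hlb.symm, by simpa using he0⟩
    have h3 := (mem_extremePoints_iff_left.mp hext).2 _ h1 _ h2 ⟨(b - x) / (b - a),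
      (x - a) / (b - a), div_pos (by linarith) hba, div_pos (by linarith) hba,
      by field_simp; ring, by
        ext
        · simp only [Prod.fst_add, Prod.smul_fst, smul_eq_mul]
          field_simp
          ring
        · simp only [Prod.snd_add, Prod.smul_snd, smul_eq_mul]
          have h4 : (b - x) / (b - a) + (x - a) / (b - a) = 1 := by field_simp; ring
          linear_combination e * h4 - he⟩
    exact hki'.ne (congrArg Prod.fst h3)
  · rintro ⟨hi, h⟩
    have hiff := mem_terms.mp hi
    refine ⟨hiff.1, hiff.2, ?_⟩
    -- The slope -m is chosen strictly between those of the chords ending at i and those of the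
    -- chords leaving i. The form y + m x then has its strict minimum at the point i.
    obtain ⟨m, hlo, hhi⟩ := Order.exists_between_finsets
      ((L.terms.filter (i < ·)).image fun l =>
        -(((L.coeff l).order - (L.coeff i).order) / ((p : ℚ) ^ l - (p : ℚ) ^ i)))
      ((L.terms.filter (· < i)).image fun k =>
        -(((L.coeff i).order - (L.coeff k).order) / ((p : ℚ) ^ i - (p : ℚ) ^ k))) (by
      intro x hx y hy
      obtain ⟨l, hl, rfl⟩ := Finset.mem_image.mp hx
      obtain ⟨k, hk, rfl⟩ := Finset.mem_image.mp hy
      rw [Finset.mem_filter] at hl hk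
      rw [neg_lt_neg_iff, div_lt_div_iff₀ (sub_pos.mpr (pow_lt_pow_of_two_le hp hk.2))
        (sub_pos.mpr (pow_lt_pow_of_two_le hp hl.2))]
      exact h k hk.1 l hl.1 hk.2 hl.2)
    have hm : ∀ k ∈ L.terms, k ≠ i → (L.coeff i).order + m * (p : ℚ) ^ i <
        (L.coeff k).order + m * (p : ℚ) ^ k := by
      intro k hk hki
      rcases lt_or_gt_of_ne hki with hlt | hlt
      · have := hhi _ (Finset.mem_image_of_mem _ (Finset.mem_filter.mpr ⟨hk, hlt⟩))
        rw [lt_neg, div_lt_iff₀ (sub_pos.mpr (pow_lt_pow_of_two_le hp hlt))] at this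
        linarith
      · have := hlo _ (Finset.mem_image_of_mem _ (Finset.mem_filter.mpr ⟨hk, hlt⟩))
        rw [neg_lt, lt_div_iff₀ (sub_pos.mpr (pow_lt_pow_of_two_le hp hlt))] at this
        linarith
    refine mem_extremePoints_convexHull ⟨i, hiff.1, hiff.2, rfl, le_rfl⟩
      (LinearMap.snd ℝ ℝ ℝ + (m : ℝ) • LinearMap.fst ℝ ℝ ℝ) ?_
    rintro ⟨x, y⟩ ⟨k, hk, hk0, hx, hy⟩ hne
    simp only at hx hy
    subst hx
    simp only [LinearMap.add_apply, LinearMap.snd_apply, LinearMap.smul_apply,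
      LinearMap.fst_apply, smul_eq_mul]
    by_cases hki : k = i
    · subst hki
      have : y ≠ ((L.coeff k).order : ℝ) := fun h => hne (by rw [h])
      linarith [lt_of_le_of_ne hy this.symm]
    · have h1 := hm k (mem_terms.mpr ⟨hk, hk0⟩) hki
      have h2 : ((L.coeff i).order : ℝ) + m * (p : ℝ) ^ i <
        (L.coeff k).order + m * (p : ℝ) ^ k := by exact_mod_cast h1
      linarith

variable {L} in
omit hp in
theorem IsVertexIndex.mem_terms {i : ℕ} (h : L.IsVertexIndex p i) : i ∈ L.terms :=
  MahlerOperator.mem_terms.mpr ⟨h.1, h.2.1⟩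

theorem isVertexIndex_zero : L.IsVertexIndex p 0 :=
  (L.isVertexIndex_iff hp).mpr ⟨L.zero_mem_terms, fun _ _ _ _ h => absurd h (Nat.not_lt_zero _)⟩

omit hp in
theorem finite_isVertexIndex : (Set.ofPred (L.IsVertexIndex p)).Finite :=
  (Set.finite_Iic L.order).subset fun _ hi => hi.1

/-- The index 0 is always a vertex, so the truncated subtraction in `numSlopes` is exact. -/
theorem lt_card_iff_le_numSlopes {j : ℕ} :
    j < (L.finite_isVertexIndex (p := p)).toFinset.card ↔ j ≤ L.numSlopes p := by
  have h0 : 0 < (L.finite_isVertexIndex (p := p)).toFinset.card :=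
    Finset.card_pos.mpr ⟨0, (Set.Finite.mem_toFinset _).mpr (L.isVertexIndex_zero hp)⟩
  have h1 : Set.ncard {i | L.IsVertexIndex p i} =
    (L.finite_isVertexIndex (p := p)).toFinset.card := Set.ncard_eq_toFinset_card _ _
  rw [numSlopes, h1]
  omega

theorem isVertexIndex_alpha {j : ℕ} (hj : j ≤ L.numSlopes p) :
    L.IsVertexIndex p (L.alpha p j) :=
  Nat.nth_mem_of_lt_card L.finite_isVertexIndex ((L.lt_card_iff_le_numSlopes hp).mpr hj)

theorem alpha_lt_alpha {i j : ℕ} (hij : i < j) (hj : j ≤ L.numSlopes p) :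
    L.alpha p i < L.alpha p j :=
  Nat.nth_strictMonoOn L.finite_isVertexIndex
    ((L.lt_card_iff_le_numSlopes hp).mpr (hij.le.trans hj))
    ((L.lt_card_iff_le_numSlopes hp).mpr hj) hij

variable {L} in
theorem IsVertexIndex.exists_alpha_eq {i : ℕ} (h : L.IsVertexIndex p i) :
    ∃ j ≤ L.numSlopes p, L.alpha p j = i := by
  obtain ⟨j, hj, e⟩ := Nat.exists_lt_card_finite_nth_eq L.finite_isVertexIndex h
  exact ⟨j, (L.lt_card_iff_le_numSlopes hp).mp hj, e⟩

theorem alpha_zero : L.alpha p 0 = 0 := by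
  obtain ⟨j, hj, e⟩ := (L.isVertexIndex_zero hp).exists_alpha_eq hp
  rcases Nat.eq_zero_or_pos j with rfl | h
  · exact e
  · have := L.alpha_lt_alpha hp h hj
    omega

theorem not_isVertexIndex_between {j : ℕ} (hj : j + 1 ≤ L.numSlopes p) {i : ℕ}
    (h1 : L.alpha p j < i) (h2 : i < L.alpha p (j + 1)) : ¬ L.IsVertexIndex p i := by
  intro h
  obtain ⟨t, ht, rfl⟩ := h.exists_alpha_eq hp
  rcases Nat.lt_or_ge j t with h' | h'
  · rcases (Nat.succ_le_of_lt h').lt_or_eq with h'' | rfl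
    · exact lt_asymm h2 (L.alpha_lt_alpha hp h'' ht)
    · exact lt_irrefl _ h2
  · rcases h'.lt_or_eq with h'' | rfl
    · exact lt_asymm h1 (L.alpha_lt_alpha hp h'' (by omega))
    · exact lt_irrefl _ h1

omit hp in
theorem slope_succ (j : ℕ) : L.slope p (j + 1) =
    ((L.coeff (L.alpha p (j + 1))).order - (L.coeff (L.alpha p j)).order)
      / ((p : ℚ) ^ L.alpha p (j + 1) - (p : ℚ) ^ L.alpha p j) := rfl

theorem slope_succ_mul {j : ℕ} (hj : j + 1 ≤ L.numSlopes p) : L.slope p (j + 1) *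
    ((p : ℚ) ^ L.alpha p (j + 1) - (p : ℚ) ^ L.alpha p j) =
    (L.coeff (L.alpha p (j + 1))).order - (L.coeff (L.alpha p j)).order := by
  rw [slope_succ, div_mul_cancel₀]
  exact (sub_pos.mpr (pow_lt_pow_of_two_le hp (L.alpha_lt_alpha hp (Nat.lt_succ_self j) hj))).ne'

theorem slope_lt_slope_succ {j : ℕ} (hj : j + 2 ≤ L.numSlopes p) :
    L.slope p (j + 1) < L.slope p (j + 2) := by
  have h01 := L.alpha_lt_alpha hp (Nat.lt_succ_self j) (by omega)
  have h12 := L.alpha_lt_alpha hp (Nat.lt_succ_self (j + 1)) hj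
  have hv := ((L.isVertexIndex_iff hp).mp (L.isVertexIndex_alpha hp (j := j + 1) (by omega))).2
    _ (L.isVertexIndex_alpha hp (j := j) (by omega)).mem_terms
    _ (L.isVertexIndex_alpha hp hj).mem_terms h01 h12
  rw [slope_succ, slope_succ, div_lt_div_iff₀ (sub_pos.mpr (pow_lt_pow_of_two_le hp h01))
    (sub_pos.mpr (pow_lt_pow_of_two_le hp h12))]
  exact hv

theorem slope_lt_slope {i j : ℕ} (hi : 1 ≤ i) (hij : i < j) (hj : j ≤ L.numSlopes p) :
    L.slope p i < L.slope p j := by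
  obtain ⟨i, rfl⟩ := Nat.exists_eq_add_of_le' hi
  induction j, hij using Nat.le_induction with
  | base => exact L.slope_lt_slope_succ hp hj
  | succ j hij ih =>
    obtain ⟨l, rfl⟩ := Nat.exists_eq_add_of_le' (hi.trans (Nat.le_of_succ_le hij))
    exact (ih (by omega)).trans (L.slope_lt_slope_succ hp hj)

/-- The smallest and the largest index at which `val_z(a_i) + p^i γ` is minimal belong to
vertices. -/
theorem isVertexIndex_of_minimal {γ : ℚ} {a : ℕ} (ha : a ∈ L.terms)
    (hmin : ∀ l ∈ L.terms, (L.coeff a).order + (p : ℚ) ^ a * γ ≤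
      (L.coeff l).order + (p : ℚ) ^ l * γ)
    (hlt : (∀ k ∈ L.terms, k < a → (L.coeff a).order + (p : ℚ) ^ a * γ <
      (L.coeff k).order + (p : ℚ) ^ k * γ) ∨ ∀ l ∈ L.terms, a < l →
      (L.coeff a).order + (p : ℚ) ^ a * γ < (L.coeff l).order + (p : ℚ) ^ l * γ) :
    L.IsVertexIndex p a := by
  refine (L.isVertexIndex_iff hp).mpr ⟨ha, fun k hk l hl hka hal => ?_⟩
  have h1 := sub_pos.mpr (pow_lt_pow_of_two_le hp hka)
  have h2 := sub_pos.mpr (pow_lt_pow_of_two_le hp hal)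
  have h3 := hmin k hk
  have h4 := hmin l hl
  rcases hlt with h | h
  · have h5 := mul_lt_mul_of_pos_right (show (L.coeff a).order - (L.coeff k).order <
      -γ * ((p : ℚ) ^ a - (p : ℚ) ^ k) by linarith [h k hk hka]) h2
    have h6 := mul_le_mul_of_nonneg_right (show -γ * ((p : ℚ) ^ l - (p : ℚ) ^ a) ≤
      (L.coeff l).order - (L.coeff a).order by linarith) h1.le
    linarith
  · have h5 := mul_le_mul_of_nonneg_right (show (L.coeff a).order - (L.coeff k).order ≤
      -γ * ((p : ℚ) ^ a - (p : ℚ) ^ k) by linarith) h2.le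
    have h6 := mul_lt_mul_of_pos_right (show -γ * ((p : ℚ) ^ l - (p : ℚ) ^ a) <
      (L.coeff l).order - (L.coeff a).order by linarith [h l hl hal]) h1
    linarith

/-- The edge of slope `μ_{j+1}` lies on a supporting line of the Newton polygon. -/
theorem minVal_neg_slope_succ {j : ℕ} (hj : j + 1 ≤ L.numSlopes p) :
    L.minVal p (-L.slope p (j + 1)) = (L.coeff (L.alpha p j)).order -
      (p : ℚ) ^ L.alpha p j * L.slope p (j + 1) := by
  classical
  have hab := L.alpha_lt_alpha hp (Nat.lt_succ_self j) hj
  have hva := L.isVertexIndex_alpha hp (j := j) (by omega)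
  have hvb := L.isVertexIndex_alpha hp hj
  have hμ := L.slope_succ_mul hp hj
  have hbet := fun i => L.not_isVertexIndex_between hp hj (i := i)
  set μ := L.slope p (j + 1)
  generalize L.alpha p j = a at *
  generalize L.alpha p (j + 1) = b at *
  have hab' := sub_pos.mpr (pow_lt_pow_of_two_le hp hab)
  refine le_antisymm ?_ ?_
  · linarith [minVal_le p hva.mem_terms (-μ)]
  by_contra! hlt
  -- If the minimum were below the edge, the least index reaching it would be a vertex. Convexity at
  -- a and at b would place it strictly between these two consecutive vertices.
  let I := L.terms.filter fun i => L.minVal p (-μ) = (L.coeff i).order + (p : ℚ) ^ i * (-μ)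
  have hI : I.Nonempty := by
    obtain ⟨i, hi, h⟩ := L.exists_minVal_eq p (-μ)
    exact ⟨i, Finset.mem_filter.mpr ⟨hi, h⟩⟩
  obtain ⟨hi, he⟩ := Finset.mem_filter.mp (I.min'_mem hI)
  have hmin : ∀ l ∈ I, I.min' hI ≤ l := fun l hl => I.min'_le l hl
  generalize I.min' hI = i at *
  have hvi : L.IsVertexIndex p i := by
    refine L.isVertexIndex_of_minimal hp hi (fun l hl => he ▸ minVal_le p hl _)
      (Or.inl fun k hk hki => he ▸ lt_of_le_of_ne (minVal_le p hk _) fun h => ?_)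
    exact absurd (hmin k (Finset.mem_filter.mpr ⟨hk, h⟩)) (not_le.mpr hki)
  have hai : a < i := by
    by_contra! h
    rcases h.lt_or_eq with h | rfl
    · have := ((L.isVertexIndex_iff hp).mp hva).2 i hi b hvb.mem_terms h hab
      rw [← hμ, mul_right_comm] at this
      have := lt_of_mul_lt_mul_right this hab'.le
      linarith
    · linarith
  have hib : i < b := by
    by_contra! h
    rcases h.lt_or_eq with h | rfl
    · have := ((L.isVertexIndex_iff hp).mp hvb).2 a hva.mem_terms i hi hab h
      rw [← hμ, mul_right_comm] at this
      have := lt_of_mul_lt_mul_right this hab'.le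
      linarith
    · linarith
  exact hbet i hai hib hvi

/-- A line supporting the Newton polygon along an edge has the slope of this edge. -/
theorem exists_slope_eq {γ : ℚ} {i l : ℕ} (hi : i ∈ L.terms) (hl : l ∈ L.terms) (hne : i ≠ l)
    (hi' : L.minVal p γ = (L.coeff i).order + (p : ℚ) ^ i * γ)
    (hl' : L.minVal p γ = (L.coeff l).order + (p : ℚ) ^ l * γ) :
    ∃ j, j + 1 ≤ L.numSlopes p ∧ γ = -L.slope p (j + 1) := by
  classical
  let I := L.terms.filter fun i => L.minVal p γ = (L.coeff i).order + (p : ℚ) ^ i * γ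
  have hiI : i ∈ I := Finset.mem_filter.mpr ⟨hi, hi'⟩
  have hlI : l ∈ I := Finset.mem_filter.mpr ⟨hl, hl'⟩
  have hI : I.Nonempty := ⟨i, hiI⟩
  have hab : I.min' hI < I.max' hI := by
    have h1 := I.min'_le i hiI
    have h2 := I.le_max' i hiI
    have h3 := I.min'_le l hlI
    have h4 := I.le_max' l hlI
    omega
  obtain ⟨ha, hae⟩ := Finset.mem_filter.mp (I.min'_mem hI)
  obtain ⟨hb, hbe⟩ := Finset.mem_filter.mp (I.max'_mem hI)
  have hva : L.IsVertexIndex p (I.min' hI) := by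
    refine L.isVertexIndex_of_minimal hp ha (fun l hl => hae ▸ minVal_le p hl _)
      (Or.inl fun k hk hka => hae ▸ lt_of_le_of_ne (minVal_le p hk _) fun h => ?_)
    exact absurd (I.min'_le k (Finset.mem_filter.mpr ⟨hk, h⟩)) (not_le.mpr hka)
  have hvb : L.IsVertexIndex p (I.max' hI) := by
    refine L.isVertexIndex_of_minimal hp hb (fun l hl => hbe ▸ minVal_le p hl _)
      (Or.inr fun k hk hkb => hbe ▸ lt_of_le_of_ne (minVal_le p hk _) fun h => ?_)
    exact absurd (I.le_max' k (Finset.mem_filter.mpr ⟨hk, h⟩)) (not_le.mpr hkb)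
  generalize I.min' hI = a at *
  generalize I.max' hI = b at *
  -- A vertex strictly between a and b would lie strictly below the supporting line.
  have hbet : ∀ t, a < t → t < b → ¬ L.IsVertexIndex p t := by
    intro t hat htb hvt
    have h1 := ((L.isVertexIndex_iff hp).mp hvt).2 a ha b hb hat htb
    have h2 := sub_pos.mpr (pow_lt_pow_of_two_le hp hat)
    have h3 := sub_pos.mpr (pow_lt_pow_of_two_le hp htb)
    have h4 := minVal_le p hvt.mem_terms γ
    have h5 := mul_le_mul_of_nonneg_right (show -γ * ((p : ℚ) ^ t - (p : ℚ) ^ a) ≤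
      (L.coeff t).order - (L.coeff a).order by linarith) h3.le
    have h6 := mul_le_mul_of_nonneg_right (show (L.coeff b).order - (L.coeff t).order ≤
      -γ * ((p : ℚ) ^ b - (p : ℚ) ^ t) by linarith) h2.le
    linarith
  obtain ⟨t, ht, rfl⟩ := hvb.exists_alpha_eq hp
  rcases t with - | t
  · rw [L.alpha_zero hp] at hab
    omega
  have hat : a = L.alpha p t := by
    obtain ⟨s, hs, rfl⟩ := hva.exists_alpha_eq hp
    have hst : s ≤ t := by
      by_contra! h
      rcases (Nat.succ_le_of_lt h).lt_or_eq with h' | rfl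
      · exact lt_asymm hab (L.alpha_lt_alpha hp h' hs)
      · exact lt_irrefl _ hab
    rcases hst.lt_or_eq with h | rfl
    · exact absurd (L.isVertexIndex_alpha hp (by omega)) (hbet _ (L.alpha_lt_alpha hp h (by omega))
        (L.alpha_lt_alpha hp (Nat.lt_succ_self t) ht))
    · rfl
  subst hat
  refine ⟨t, ht, ?_⟩
  have h1 := sub_pos.mpr (pow_lt_pow_of_two_le hp hab)
  rw [slope_succ, eq_neg_iff_add_eq_zero]
  field_simp
  linarith

omit hp in
theorem sum_slopeMult (j : ℕ) (hmono : ∀ i < j, L.alpha p i < L.alpha p (i + 1)) :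
    ∑ l ∈ Finset.Icc 1 j, L.slopeMult p l + L.alpha p 0 = L.alpha p j := by
  induction j with
  | zero => simp
  | succ j ih =>
    rw [Finset.sum_Icc_succ_top (by omega), add_right_comm,
      ih fun i hi => hmono i (by omega), slopeMult, Nat.add_sub_cancel]
    have := hmono j (by omega)
    omega

/-- Two consecutive edges share a vertex, of index α_i = r_1 + ⋯ + r_i. Computing T(-μ_i) and
T(-μ_{i+1}) there gives the difference -p^{α_i}(μ_{i+1} - μ_i), so the sum defining ν_j telescopes.
Hence the right-hand side of the Frobenius equation starts at T(-μ_j). -/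
theorem minVal_neg_slope_eq_sub_nu {j : ℕ} (hj : j + 1 ≤ L.numSlopes p) :
    L.minVal p (-L.slope p (j + 1)) = (L.coeff 0).order - L.nu p (j + 1) / ((p : ℚ) - 1) := by
  have hp1 : (p : ℚ) - 1 ≠ 0 := by
    have : (2 : ℚ) ≤ p := by exact_mod_cast hp
    linarith
  rw [nu, mul_div_cancel_left₀ _ hp1]
  induction j with
  | zero => rw [L.minVal_neg_slope_succ hp hj, L.alpha_zero hp]; simp
  | succ j ih =>
    have h1 := ih (by omega)
    have h2 := L.minVal_neg_slope_succ hp hj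
    have h3 := L.minVal_neg_slope_succ hp (j := j) (by omega)
    have h4 := L.slope_succ_mul hp (j := j) (by omega)
    have h5 := L.sum_slopeMult (j + 1) fun i hi =>
      L.alpha_lt_alpha hp (Nat.lt_succ_self i) (by omega)
    rw [L.alpha_zero hp, add_zero] at h5
    rw [Finset.sum_Icc_succ_top (by omega), Nat.add_sub_cancel, h5, h2]
    linarith

/-! ### Nonzero roots of the face polynomials, and the exponents -/

omit hp in
-- If a single index reached the minimum, `facePoly` would be a monomial, with no nonzero root.
theorem exists_two_terms_of_isRoot {γ : ℚ} {c : ℂ} (hc0 : c ≠ 0)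
    (hc : (L.facePoly p γ).IsRoot c) : ∃ i ∈ L.terms, ∃ l ∈ L.terms, i ≠ l ∧
      L.minVal p γ = (L.coeff i).order + (p : ℚ) ^ i * γ ∧
      L.minVal p γ = (L.coeff l).order + (p : ℚ) ^ l * γ := by
  obtain ⟨i, hi, hi'⟩ := L.exists_minVal_eq p γ
  by_contra! hcon
  have hz : ∀ l ≤ L.order, l ≠ i →
      (L.coeff l).coeff (L.minVal p γ - (p : ℚ) ^ l * γ) = 0 := by
    intro l hl hli
    by_contra h0
    have hl' : l ∈ L.terms := mem_terms.mpr ⟨hl, fun h => h0 (by rw [h, HahnSeries.coeff_zero])⟩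
    have h1 := HahnSeries.order_le_of_coeff_ne_zero h0
    have h2 := minVal_le p hl' γ
    exact hcon i hi l hl' hli.symm hi' (by linarith)
  rw [Polynomial.IsRoot.def, facePoly, Polynomial.eval_finsetSum,
    Finset.sum_eq_single i] at hc
  · rw [hi', add_sub_cancel_right] at hc
    simp only [Polynomial.eval_mul, Polynomial.eval_C, Polynomial.eval_pow, Polynomial.eval_X,
      mul_eq_zero, HahnSeries.coeff_order_eq_zero] at hc
    exact hc.elim (mem_terms.mp hi).2 (pow_ne_zero _ hc0)
  · intro l hl hli
    rw [hz l (Nat.lt_succ_iff.mp (Finset.mem_range.mp hl)) hli]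
    simp
  · intro h
    exact absurd (Finset.mem_range.mpr (Nat.lt_succ_iff.mpr (mem_terms.mp hi).1)) h

theorem exists_slope_eq_of_isRoot {γ : ℚ} {c : ℂ} (hc0 : c ≠ 0)
    (hc : (L.facePoly p γ).IsRoot c) : ∃ j, j + 1 ≤ L.numSlopes p ∧ γ = -L.slope p (j + 1) := by
  obtain ⟨i, hi, l, hl, hne, hi', hl'⟩ := L.exists_two_terms_of_isRoot hc0 hc
  exact L.exists_slope_eq hp hi hl hne hi' hl'

theorem val_gauge (μ : ℚ) :
    (L.gauge p (-((p : ℚ) - 1) * μ)).val = L.minVal p (-μ) + μ := by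
  have hp1 : (p : ℚ) - 1 ≠ 0 := by
    have : (2 : ℚ) ≤ p := by exact_mod_cast hp
    linarith
  have hshift : ∀ i : ℕ, ((p : ℚ) ^ i - 1) / ((p : ℚ) - 1) * (-((p : ℚ) - 1) * μ) =
      -((p : ℚ) ^ i * μ) + μ := fun i => by field_simp; ring
  -- The minimum is finite since a_0 ≠ 0, so the default value in `val` never intervenes.
  have key : ((Finset.range (L.order + 1)).inf fun i =>
      ((L.gauge p (-((p : ℚ) - 1) * μ)).coeff i).orderTop) =
        ((L.minVal p (-μ) + μ : ℚ) : WithTop ℚ) := by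
    have hterm : ∀ i ∈ L.terms, ((L.gauge p (-((p : ℚ) - 1) * μ)).coeff i).orderTop =
        (((L.coeff i).order + (p : ℚ) ^ i * -μ + μ : ℚ) : WithTop ℚ) := by
      intro i hi
      change (HahnSeries.single _ 1 * L.coeff i).orderTop = _
      rw [HahnSeries.orderTop_mul, HahnSeries.orderTop_single one_ne_zero,
        ← HahnSeries.order_eq_orderTop_of_ne_zero (mem_terms.mp hi).2, hshift, ← WithTop.coe_add]
      congr 1
      ring
    refine le_antisymm ?_ ?_
    · obtain ⟨i, hi, h⟩ := L.exists_minVal_eq p (-μ)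
      refine (Finset.inf_le (Finset.mem_range.mpr
        (Nat.lt_succ_iff.mpr (mem_terms.mp hi).1))).trans_eq ?_
      rw [hterm i hi, h]
    · refine Finset.le_inf fun i hi => ?_
      by_cases h0 : L.coeff i = 0
      · have : (L.gauge p (-((p : ℚ) - 1) * μ)).coeff i = 0 := by
          change HahnSeries.single _ 1 * L.coeff i = 0
          rw [h0, mul_zero]
        rw [this, HahnSeries.orderTop_zero]
        exact le_top
      · have hi' : i ∈ L.terms := mem_terms.mpr
          ⟨Nat.lt_succ_iff.mp (Finset.mem_range.mp hi), h0⟩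
        rw [hterm i hi', WithTop.coe_le_coe]
        linarith [minVal_le p hi' (-μ)]
  change WithTop.untopD 0 ((Finset.range (L.order + 1)).inf fun i =>
      ((L.gauge p (-((p : ℚ) - 1) * μ)).coeff i).orderTop) = _
  rw [key, WithTop.untopD_coe]

/-- The gauge shifts a_i by -(p^i - 1)μ_j = -p^i μ_j + μ_j. The extra μ_j also occurs in `val_gauge`
and cancels, so both polynomials read a_i at the same exponent. -/
theorem charPoly_eq_facePoly (j : ℕ) : L.charPoly p j = L.facePoly p (-L.slope p j) := by
  have hp1 : (p : ℚ) - 1 ≠ 0 := by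
    have : (2 : ℚ) ≤ p := by exact_mod_cast hp
    linarith
  rw [charPoly, leadingPoly, facePoly, L.val_gauge hp]
  refine Finset.sum_congr rfl fun i _ => ?_
  have e : 0 - -(L.minVal p (-L.slope p j) + L.slope p j) -
      ((p : ℚ) ^ i - 1) / ((p : ℚ) - 1) * (-((p : ℚ) - 1) * L.slope p j) =
      L.minVal p (-L.slope p j) - (p : ℚ) ^ i * -L.slope p j := by
    field_simp
    ring
  rw [← e, gauge]
  simp only [HahnSeries.coeff_single_mul, one_mul]

end MahlerOperator

/-! ## The derivation `∂_λ` and the evaluation at `λ = c` -/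

theorem ratDeriv_algebraMap (q : Polynomial ℂ) :
    ratDeriv (algebraMap _ (RatFunc ℂ) q) = algebraMap _ (RatFunc ℂ) q.derivative := by
  change ratDerivFun _ = _
  simpa using ratDerivFun_div q 1 one_ne_zero

theorem ratDeriv_C (a : ℂ) : ratDeriv (RatFunc.C a) = 0 := by
  simpa using ratDeriv_algebraMap (Polynomial.C a)

theorem ratDeriv_X_sub_C (c : ℂ) : ratDeriv (RatFunc.X - RatFunc.C c) = 1 := by
  rw [X_sub_C_eq_algebraMap, ratDeriv_algebraMap]
  simp

theorem ratDeriv_X : ratDeriv RatFunc.X = 1 := by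
  simpa using ratDeriv_algebraMap Polynomial.X

theorem ratDeriv_mem_regularAt {c : ℂ} {f : RatFunc ℂ} (hf : f ∈ regularAt c) :
    ratDeriv f ∈ regularAt c := by
  have hf' : (f.denom ^ 2).eval c ≠ 0 := by
    rw [Polynomial.eval_pow]
    exact pow_ne_zero 2 hf
  change ratDerivFun f ∈ regularAt c
  rw [ratDerivFun, div_eq_mul_inv, ← map_pow]
  exact mul_mem (sub_mem (mul_mem (algebraMap_mem_regularAt c _) (algebraMap_mem_regularAt c _))
    (mul_mem (algebraMap_mem_regularAt c _) (algebraMap_mem_regularAt c _)))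
    (inv_algebraMap_mem_regularAt hf')

theorem exists_hahnMap_subtype_eq {c : ℂ} {x : Hahn (RatFunc ℂ)}
    (hx : ∀ γ, x.coeff γ ∈ regularAt c) :
    ∃ y : Hahn (regularAt c), hahnMap (regularAt c).subtype y = x := by
  refine ⟨⟨fun γ => ⟨x.coeff γ, hx γ⟩, x.isPWO_support.mono fun γ h => ?_⟩, by ext γ; rfl⟩
  exact fun h0 => h (Subtype.ext h0)

theorem C_mem_RLamAt {c : ℂ} {x : Hahn (RatFunc ℂ)} (hx : ∀ γ, x.coeff γ ∈ regularAt c) :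
    MvPolynomial.C x ∈ RLamAt c := by
  obtain ⟨y, rfl⟩ := exists_hahnMap_subtype_eq hx
  exact ⟨MvPolynomial.C y, MvPolynomial.map_C _ _⟩

theorem X_mem_RLamAt (c : ℂ) (i : ℕ) : (MvPolynomial.X i : RLam) ∈ RLamAt c :=
  ⟨MvPolynomial.X i, MvPolynomial.map_X _ _⟩

theorem dLam_mem_RLamAt {c : ℂ} {y : RLam} (hy : y ∈ RLamAt c) : dLam y ∈ RLamAt c := by
  obtain ⟨y, rfl⟩ := hy
  induction y using MvPolynomial.induction_on with
  | C a =>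
    rw [inclLam, MvPolynomial.map_C, dLam_C]
    exact C_mem_RLamAt fun γ => ratDeriv_mem_regularAt (a.coeff γ).2
  | add y z hy hz =>
    rw [map_add, map_add]
    exact add_mem hy hz
  | mul_X y i hy =>
    have hX : inclLam c (MvPolynomial.X i) = MvPolynomial.X i := MvPolynomial.map_X _ _
    rw [map_mul, dLam_mul, hX, dLam_X]
    exact add_mem (mul_mem ⟨y, rfl⟩ (X_mem_RLamAt c _)) (mul_mem (X_mem_RLamAt c _) hy)

theorem dLam_iterate_mem_RLamAt {c : ℂ} {y : RLam} (hy : y ∈ RLamAt c) (k : ℕ) :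
    dLam^[k] y ∈ RLamAt c := by
  induction k with
  | zero => exact hy
  | succ k ih =>
    rw [Function.iterate_succ_apply']
    exact dLam_mem_RLamAt ih

theorem hahnDeriv_C (f : RatFunc ℂ) :
    hahnDeriv ratDeriv (HahnSeries.C f) = HahnSeries.C (ratDeriv f) := by
  ext γ
  rw [hahnDeriv_coeff, HahnSeries.C_apply, HahnSeries.C_apply]
  by_cases h : γ = 0
  · rw [h, HahnSeries.coeff_single_same, HahnSeries.coeff_single_same]
  · rw [HahnSeries.coeff_single_of_ne h, HahnSeries.coeff_single_of_ne h, map_zero]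

/-- Leibniz's rule, as the second derivative of λ vanishes. For i = 0 the truncated index i - 1 is
harmless: its term has the factor 0. -/
theorem dLam_C_mul_X (i : ℕ) : dLam^[i] (MvPolynomial.C (HahnSeries.C RatFunc.X) * eLam) =
    MvPolynomial.C (HahnSeries.C RatFunc.X) * MvPolynomial.X i +
      (i : RLam) * MvPolynomial.X (i - 1) := by
  have hnat : ∀ n : ℕ, dLam (n : RLam) = 0 := fun n => by
    have h1 : dLam (1 : RLam) = 0 := by simpa using dLam_mul 1 1
    rw [← nsmul_one, map_nsmul, h1, nsmul_zero]
  induction i with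
  | zero => simp [eLam]
  | succ i ih =>
    rw [Function.iterate_succ_apply', ih, map_add, dLam_mul, dLam_mul, dLam_C, hahnDeriv_C,
      ratDeriv_X, dLam_X, dLam_X, hnat]
    rcases i with - | i
    · simp
    · simp only [map_one, Nat.add_sub_cancel]
      push_cast
      ring

/-- On coefficients, φ_p moves the exponents of z while ∂_λ acts on functions of λ; on the
indeterminates, commutation is built into the definition of φ_p. -/
theorem dLam_phiLam {p : ℕ} (hp : 2 ≤ p) (y : RLam) :
    dLam (phiLam hp y) = phiLam hp (dLam y) := by
  have hX : ∀ i, phiLam hp (MvPolynomial.X i) =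
      dLam^[i] (MvPolynomial.C (HahnSeries.C RatFunc.X) * eLam) := fun i => by simp [phiLam]
  induction y using MvPolynomial.induction_on with
  | C a =>
    have hC : ∀ f, phiLam hp (MvPolynomial.C f) = MvPolynomial.C (mahler hp _ f) := fun f => by
      simp [phiLam]
    rw [hC, dLam_C, dLam_C, hC]
    congr 1
    ext γ
    have := mahler_iterate_coeff hp (A := RatFunc ℂ) 1
    simp only [Function.iterate_one] at this
    rw [hahnDeriv_coeff, this, this, hahnDeriv_coeff]
  | add y z hy hz => rw [map_add, map_add, hy, hz, map_add, map_add]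
  | mul_X y i hy =>
    have hX' : dLam (phiLam hp (MvPolynomial.X i)) = phiLam hp (MvPolynomial.X (i + 1)) := by
      rw [hX, hX, Function.iterate_succ_apply']
    rw [map_mul, dLam_mul, hy, hX', dLam_mul, dLam_X]
    simp only [map_add, map_mul]

theorem dLam_constLam_mul (a : Hahn ℂ) (y : RLam) :
    dLam (constLam a * y) = constLam a * dLam y := by
  have h : hahnDeriv ratDeriv (hahnMap RatFunc.C a) = 0 := by
    ext γ
    simp [ratDeriv_C]
  rw [dLam_mul, constLam, RingHom.comp_apply, dLam_C, h, map_zero, mul_zero, add_zero]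

namespace MahlerOperator

variable {p : ℕ} (hp : 2 ≤ p) (L : MahlerOperator)

theorem dLam_apply (y : RLam) : dLam (L.apply constLam (phiLam hp) y) =
    L.apply constLam (phiLam hp) (dLam y) := by
  have hiter : ∀ i, dLam ((⇑(phiLam hp))^[i] y) = (⇑(phiLam hp))^[i] (dLam y) := fun i =>
    ((show Function.Commute (⇑dLam) (⇑(phiLam hp)) from dLam_phiLam hp).iterate_right i) y
  simp only [apply, map_sum, dLam_constLam_mul, hiter]

theorem dLam_iterate_apply (k : ℕ) (y : RLam) : dLam^[k] (L.apply constLam (phiLam hp) y) =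
    L.apply constLam (phiLam hp) (dLam^[k] y) :=
  ((show Function.Commute (⇑dLam) (L.apply constLam (phiLam hp)) from
    L.dLam_apply hp).iterate_left k) y

theorem map_apply {A B : Type*} [CommRing A] [CommRing B] (f : A →+* B) {ι : Hahn ℂ →+* A}
    {φ : A →+* A} {ι' : Hahn ℂ →+* B} {φ' : B →+* B} (hι : f.comp ι = ι')
    (hφ : f.comp φ = φ'.comp f) (y : A) : f (L.apply ι φ y) = L.apply ι' φ' (f y) := by
  have hiter : ∀ i, f ((⇑φ)^[i] y) = (⇑φ')^[i] (f y) := fun i =>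
    (show Function.Semiconj (⇑f) (⇑φ) (⇑φ') from fun x => congrArg (· x) hφ).iterate_right i y
  subst hι
  simp only [apply, map_sum, map_mul, hiter, RingHom.comp_apply]

end MahlerOperator

/-! ### Descent of φ_p to the ring over ℂ[λ]_{(λ-c)}, and specialization at c -/

variable {p : ℕ} (hp : 2 ≤ p)

theorem C_mem_regularAt (c a : ℂ) : (RatFunc.C a : RatFunc ℂ) ∈ regularAt c := by
  simpa using algebraMap_mem_regularAt c (Polynomial.C a)

theorem X_mem_regularAt (c : ℂ) : (RatFunc.X : RatFunc ℂ) ∈ regularAt c := by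
  simpa using algebraMap_mem_regularAt c Polynomial.X

/-- The inclusion of the constants in `ℂ[λ]_{(λ-c)}`. -/
noncomputable def constRegular (c : ℂ) : ℂ →+* regularAt c :=
  RingHom.codRestrict RatFunc.C (regularAt c) (C_mem_regularAt c)

/-- The inclusion of `𝓗` in `𝓗_{ℂ[λ]_{(λ-c)}}[X, ∂X, …]`. -/
noncomputable def constAt (c : ℂ) : Hahn ℂ →+* MvPolynomial ℕ (Hahn (regularAt c)) :=
  MvPolynomial.C.comp (hahnMap (constRegular c))

/-- The operator `φ_p` on `𝓗_{ℂ[λ]_{(λ-c)}}[X, ∂X, …]`. -/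
noncomputable def phiAt (c : ℂ) :
    MvPolynomial ℕ (Hahn (regularAt c)) →+* MvPolynomial ℕ (Hahn (regularAt c)) :=
  MvPolynomial.eval₂Hom (MvPolynomial.C.comp (mahler hp (regularAt c)))
    (fun i => MvPolynomial.C (HahnSeries.C ⟨RatFunc.X, X_mem_regularAt c⟩) * MvPolynomial.X i +
      (i : MvPolynomial ℕ (Hahn (regularAt c))) * MvPolynomial.X (i - 1))

theorem hahnMap_mahler {A B : Type*} [CommRing A] [CommRing B] (f : A →+* B) (x : Hahn A) :
    hahnMap f (mahler hp A x) = mahler hp B (hahnMap f x) := by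
  ext γ
  have hA := mahler_iterate_coeff hp (A := A) 1
  have hB := mahler_iterate_coeff hp (A := B) 1
  simp only [Function.iterate_one] at hA hB
  rw [hahnMap_coeff, hA, hB, hahnMap_coeff]

theorem hahnMap_C {A B : Type*} [CommRing A] [CommRing B] (f : A →+* B) (a : A) :
    hahnMap f (HahnSeries.C a) = HahnSeries.C (f a) := by
  ext γ
  rw [hahnMap_coeff, HahnSeries.C_apply, HahnSeries.C_apply]
  by_cases h : γ = 0
  · rw [h, HahnSeries.coeff_single_same, HahnSeries.coeff_single_same]
  · rw [HahnSeries.coeff_single_of_ne h, HahnSeries.coeff_single_of_ne h, map_zero]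

theorem inclLam_comp_constAt (c : ℂ) : (inclLam c).comp (constAt c) = constLam := by
  ext1 x
  rw [constLam, constAt, RingHom.comp_apply, RingHom.comp_apply, inclLam, MvPolynomial.map_C]
  rfl

theorem inclLam_comp_phiAt (c : ℂ) :
    (inclLam c).comp (phiAt hp c) = (phiLam hp).comp (inclLam c) := by
  refine MvPolynomial.ringHom_ext (fun a => ?_) fun i => ?_
  · simp [inclLam, phiAt, phiLam, hahnMap_mahler]
  · simp only [RingHom.comp_apply, inclLam, phiAt, phiLam, MvPolynomial.coe_eval₂Hom,
      MvPolynomial.eval₂_X, MvPolynomial.map_X, dLam_C_mul_X, map_add, map_mul,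
      MvPolynomial.map_C, hahnMap_C, map_natCast]
    rfl

section Evaluation

variable {hp} {R : Type*} [CommRing R] [Algebra (Hahn ℂ) R] (S : SolutionRing hp R) (c : ℂˣ)

/-- The evaluation at `λ = c` on `𝓗_{ℂ[λ]_{(λ-c)}}[X, ∂X, …]`. -/
noncomputable def evPoly : MvPolynomial ℕ (Hahn (regularAt (c : ℂ))) →+* R :=
  MvPolynomial.eval₂Hom ((algebraMap (Hahn ℂ) R).comp (hahnMap (evalAt (c : ℂ))))
    (fun i => (i.factorial : R) * S.ell c i)

theorem ev_inclLam (y : MvPolynomial ℕ (Hahn (regularAt (c : ℂ))))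
    (hy : inclLam (c : ℂ) y ∈ RLamAt (c : ℂ)) : ev S c ⟨inclLam (c : ℂ) y, hy⟩ = evPoly S c y := by
  have : (equivRLamAt (c : ℂ)).symm ⟨inclLam (c : ℂ) y, hy⟩ = y := by
    rw [RingEquiv.symm_apply_eq]
    rfl
  change evPoly S c ((equivRLamAt (c : ℂ)).symm ⟨inclLam (c : ℂ) y, hy⟩) = _
  rw [this]

theorem evalAt_constRegular (a : ℂ) : evalAt (c : ℂ) (constRegular c a) = a := by
  change RatFunc.eval (RingHom.id ℂ) (c : ℂ) (RatFunc.C a) = a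
  simp

theorem evalAt_X : evalAt (c : ℂ) ⟨RatFunc.X, X_mem_regularAt c⟩ = c := by
  change RatFunc.eval (RingHom.id ℂ) (c : ℂ) RatFunc.X = c
  simp

theorem evPoly_comp_constAt : (evPoly S c).comp (constAt c) = algebraMap (Hahn ℂ) R := by
  ext1 x
  have : hahnMap (evalAt (c : ℂ)) (hahnMap (constRegular c) x) = x := by
    ext γ
    rw [hahnMap_coeff, hahnMap_coeff, evalAt_constRegular]
  simp [evPoly, constAt, this]

/-- The factorials match the two recursions: i! (c ℓ_{c,i} + ℓ_{c,i-1}) = c (i! ℓ_{c,i}) + i ((i-1)!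
ℓ_{c,i-1}) for i ≥ 1. -/
theorem evPoly_comp_phiAt :
    (evPoly S c).comp (phiAt hp c) = (S.phi : R →+* R).comp (evPoly S c) := by
  refine MvPolynomial.ringHom_ext (fun a => ?_) fun i => ?_
  · simp [evPoly, phiAt, hahnMap_mahler, S.phi_algebraMap]
  · simp only [RingHom.comp_apply, evPoly, phiAt, MvPolynomial.coe_eval₂Hom,
      MvPolynomial.eval₂_X, map_add, map_mul, MvPolynomial.eval₂_C, hahnMap_C, evalAt_X, map_natCast,
      RingHom.coe_coe]
    rcases i with - | i
    · rw [S.phi_ell_zero]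
      simp
    · rw [S.phi_ell_succ, Nat.add_sub_cancel, Nat.factorial_succ]
      push_cast
      ring

/-- If `L(y) = u` in `𝓡_λ`, then `L(ev_c(y)) = ev_c(u)`. -/
theorem MahlerOperator.apply_ev (L : MahlerOperator) {y u : RLam} (hy : y ∈ RLamAt (c : ℂ))
    (hu : L.apply constLam (phiLam hp) y = u) : ∃ h : u ∈ RLamAt (c : ℂ),
      L.apply (algebraMap (Hahn ℂ) R) (S.phi : R →+* R) (ev S c ⟨y, hy⟩) = ev S c ⟨u, h⟩ := by
  obtain ⟨y, rfl⟩ := id hy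
  have e := L.map_apply (A := MvPolynomial ℕ (Hahn (regularAt (c : ℂ)))) (B := RLam)
    (inclLam (c : ℂ)) (inclLam_comp_constAt (c : ℂ)) (inclLam_comp_phiAt hp (c : ℂ)) y
  rw [ev_inclLam, ← L.map_apply (evPoly S c) (evPoly_comp_constAt S c) (evPoly_comp_phiAt S c) y]
  generalize L.apply (constAt c) (phiAt hp c) y = z at *
  obtain rfl := e.trans hu
  exact ⟨⟨z, rfl⟩, (ev_inclLam S c z _).symm⟩

/-- Each derivation removes at most one factor λ-c and preserves regularity at c. -/
theorem dLam_iterate_pow_mul {y : RLam} (hy : y ∈ RLamAt (c : ℂ)) (N k : ℕ) (hk : k ≤ N) :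
    ∃ y' ∈ RLamAt (c : ℂ),
      dLam^[k] (MvPolynomial.C (HahnSeries.C (RatFunc.X - RatFunc.C (c : ℂ))) ^ N * y) =
        MvPolynomial.C (HahnSeries.C (RatFunc.X - RatFunc.C (c : ℂ))) ^ (N - k) * y' := by
  set q : RLam := MvPolynomial.C (HahnSeries.C (RatFunc.X - RatFunc.C (c : ℂ))) with hq
  have hqm : q ∈ RLamAt (c : ℂ) := C_mem_RLamAt fun γ => by
    rw [HahnSeries.C_apply, HahnSeries.coeff_single]
    split_ifs
    · exact X_sub_C_mem_regularAt _
    · exact zero_mem _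
  have hdq : dLam q = 1 := by
    rw [hq, dLam_C, hahnDeriv_C, ratDeriv_X_sub_C, map_one, map_one]
  have hpow : ∀ n : ℕ, dLam (q ^ (n + 1)) = ((n + 1 : ℕ) : RLam) * q ^ n := by
    intro n
    induction n with
    | zero => simp [hdq]
    | succ n ih =>
      rw [pow_succ, dLam_mul, ih, hdq]
      push_cast
      ring
  induction k with
  | zero => exact ⟨y, hy, rfl⟩
  | succ k ih =>
    obtain ⟨y', hy', e⟩ := ih (by omega)
    obtain ⟨n, hn⟩ : ∃ n, N - k = n + 1 := ⟨N - k - 1, by omega⟩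
    have hn' : N - (k + 1) = n := by omega
    refine ⟨q * dLam y' + ((n + 1 : ℕ) : RLam) * y', add_mem (mul_mem hqm (dLam_mem_RLamAt hy'))
      (mul_mem (natCast_mem _ _) hy'), ?_⟩
    rw [Function.iterate_succ_apply', e, hn, hn', dLam_mul, hpow]
    ring

theorem ev_X_sub_C_mul {y y' : RLam} {n : ℕ} (hn : n ≠ 0) (hy : y ∈ RLamAt (c : ℂ))
    (hy' : y' ∈ RLamAt (c : ℂ))
    (e : y = MvPolynomial.C (HahnSeries.C (RatFunc.X - RatFunc.C (c : ℂ))) ^ n * y') :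
    ev S c ⟨y, hy⟩ = 0 := by
  obtain ⟨z, rfl⟩ := hy'
  set u : regularAt (c : ℂ) := ⟨RatFunc.X, X_mem_regularAt c⟩ - constRegular c c with hu
  have e1 : y = inclLam (c : ℂ) (MvPolynomial.C (HahnSeries.C u) ^ n * z) := by
    rw [e, map_mul, map_pow]
    simp only [inclLam, MvPolynomial.map_C, hahnMap_C]
    rfl
  subst e1
  have hu0 : evalAt (c : ℂ) u = 0 := by
    rw [hu, map_sub, evalAt_X, evalAt_constRegular, sub_self]
  rw [ev_inclLam, map_mul, map_pow]
  have h0 : evPoly S c (MvPolynomial.C (HahnSeries.C u)) = 0 := by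
    rw [evPoly, MvPolynomial.coe_eval₂Hom, MvPolynomial.eval₂_C, RingHom.comp_apply, hahnMap_C,
      hu0, map_zero, map_zero]
  rw [h0, zero_pow hn, zero_mul]

end Evaluation

end MahlerFrobenius

namespace MahlerFrobenius

namespace MahlerOperator

/-! ## The solutions attached to an exponent -/

variable {p : ℕ} (hp : 2 ≤ p) (L : MahlerOperator)

/-- Elements of ℂ(λ), being constant in z, are fixed by φ_p, so each application contributes one
factor λ through φ_p(X) = λX. -/
theorem phiLam_iterate (g : Hahn (RatFunc ℂ)) (i : ℕ) :
    (⇑(phiLam hp))^[i] (MvPolynomial.C g * eLam) =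
      MvPolynomial.C (HahnSeries.C (RatFunc.X ^ i) * (⇑(mahler hp (RatFunc ℂ)))^[i] g) *
        eLam := by
  have hmC : ∀ a : RatFunc ℂ, mahler hp _ (HahnSeries.C a) = HahnSeries.C a := fun a => by
    ext γ
    have := mahler_iterate_coeff hp (A := RatFunc ℂ) 1
    simp only [Function.iterate_one, pow_one] at this
    have hp0 : (p : ℚ) ≠ 0 := by exact_mod_cast (by omega : p ≠ 0)
    rw [this, HahnSeries.C_apply, HahnSeries.coeff_single, HahnSeries.coeff_single]
    simp [hp0]
  induction i with
  | zero => simp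
  | succ i ih =>
    have hX : phiLam hp eLam = MvPolynomial.C (HahnSeries.C RatFunc.X) * eLam := by
      rw [eLam, phiLam, MvPolynomial.eval₂Hom_X', Function.iterate_zero, id, eLam]
    have hC : ∀ f, phiLam hp (MvPolynomial.C f) = MvPolynomial.C (mahler hp _ f) := fun f => by
      rw [phiLam, MvPolynomial.eval₂Hom_C, RingHom.comp_apply]
    rw [Function.iterate_succ_apply', ih, map_mul, hX, hC, map_mul, hmC, pow_succ,
      Function.iterate_succ_apply']
    simp only [map_mul]
    ring

theorem apply_C_mul_eLam (g : Hahn (RatFunc ℂ)) :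
    L.apply constLam (phiLam hp) (MvPolynomial.C g * eLam) =
      MvPolynomial.C (L.twist hp g) * eLam := by
  rw [apply, twist_apply, map_sum, Finset.sum_mul]
  refine Finset.sum_congr rfl fun i _ => ?_
  rw [phiLam_iterate, constLam, RingHom.comp_apply, ← mul_assoc, ← map_mul, mul_assoc]

theorem frobeniusEquation_iff (j : ℕ) (c : ℂˣ) (g : Hahn (RatFunc ℂ)) :
    L.FrobeniusEquation hp j c g ↔ L.twist hp g =
      HahnSeries.single ((L.coeff 0).order - L.nu p j / ((p : ℚ) - 1))
        ((RatFunc.X - RatFunc.C (c : ℂ)) ^ (L.expSum p j c + L.expMult p j c)) := by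
  rw [FrobeniusEquation, apply_C_mul_eLam]
  constructor
  · intro h
    exact MvPolynomial.C_injective _ _ (mul_right_cancel₀ (MvPolynomial.X_ne_zero 0) h)
  · intro h
    rw [h]

/-- The number of factors `λ - c` which are lost up to the exponent `γ`. -/
noncomputable def lossUpTo (p : ℕ) (L : MahlerOperator) (j : ℕ) (c : ℂˣ) (γ : ℚ) : ℕ :=
  ∑ i ∈ (Finset.Icc 1 j).filter fun i => -L.slope p i ≤ γ, L.expMult p i c

theorem lossUpTo_le {j : ℕ} (hj : 1 ≤ j) (c : ℂˣ) (γ : ℚ) :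
    L.lossUpTo p j c γ ≤ L.expSum p j c + L.expMult p j c := by
  obtain ⟨j, rfl⟩ := Nat.exists_eq_add_of_le' hj
  rw [expSum, Nat.add_sub_cancel, ← Finset.sum_Icc_succ_top (by omega)]
  exact Finset.sum_le_sum_of_subset (Finset.filter_subset _ _)

include hp in
-- A root at c forces γ = -μ_t, and t ≤ j since the slopes increase and γ ≥ -μ_j. The index t is
-- counted at γ but not at any smaller γ'.
theorem lossUpTo_add_le {j : ℕ} (hj : 1 ≤ j) (c : ℂˣ) {γ γ' : ℚ}
    (hγ : -L.slope p j ≤ γ) (hlt : γ' < γ) :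
    L.lossUpTo p j c γ' + (L.facePoly p γ).rootMultiplicity (c : ℂ) ≤ L.lossUpTo p j c γ := by
  have hsub : ((Finset.Icc 1 j).filter fun i => -L.slope p i ≤ γ') ⊆
      (Finset.Icc 1 j).filter fun i => -L.slope p i ≤ γ :=
    Finset.monotone_filter_right _ fun i _ hi => le_trans hi hlt.le
  rcases Nat.eq_zero_or_pos ((L.facePoly p γ).rootMultiplicity (c : ℂ)) with h0 | h0
  · rw [h0, add_zero]
    exact Finset.sum_le_sum_of_subset hsub
  · obtain ⟨t, ht, rfl⟩ := L.exists_slope_eq_of_isRoot hp c.ne_zero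
      ((Polynomial.rootMultiplicity_pos (L.facePoly_ne_zero γ)).mp h0)
    have htj : t + 1 ≤ j := by
      by_contra! h
      linarith [L.slope_lt_slope hp hj h ht]
    rw [← L.charPoly_eq_facePoly hp, add_comm]
    change L.expMult p (t + 1) c + _ ≤ _
    have hnot : t + 1 ∉ (Finset.Icc 1 j).filter fun i => -L.slope p i ≤ γ' := fun h =>
      absurd (Finset.mem_filter.mp h).2 (not_le.mpr hlt)
    rw [lossUpTo, ← Finset.sum_insert (f := fun i => L.expMult p i c) hnot]
    refine Finset.sum_le_sum_of_subset (Finset.insert_subset ?_ hsub)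
    exact Finset.mem_filter.mpr ⟨Finset.mem_Icc.mpr ⟨by omega, htj⟩, le_rfl⟩

/-- Well-founded induction on the support of g, through a least bad exponent β. The coefficient of
Λ(g) at T(β) is P_β times that of g at β, plus a contribution of the terms below β, already
controlled. Dividing by P_β costs what `lossUpTo` gains at β. -/
theorem coeff_mem_powIdeal {j : ℕ} (hj : 1 ≤ j) (hjk : j ≤ L.numSlopes p) (c : ℂˣ)
    {g : Hahn (RatFunc ℂ)} (hg : L.FrobeniusEquation hp j c g) (γ : ℚ) :
    g.coeff γ ∈ powIdeal (c : ℂ) (L.expSum p j c + L.expMult p j c - L.lossUpTo p j c γ) := by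
  rw [frobeniusEquation_iff] at hg
  have hT : (L.coeff 0).order - L.nu p j / ((p : ℚ) - 1) = L.minVal p (-L.slope p j) := by
    obtain ⟨j, rfl⟩ := Nat.exists_eq_add_of_le' hj
    exact (L.minVal_neg_slope_eq_sub_nu hp hjk).symm
  rw [hT] at hg
  have hlead := L.hasLeadingTerms_twist hp
  -- T is strictly increasing and Λ(g) starts at T(-μ_j), so g has no term before -μ_j. The slopes
  -- beyond μ_j never enter.
  have hvan : ∀ γ < -L.slope p j, g.coeff γ = 0 := by
    intro γ hγ
    by_contra h0
    have h1 := hlead.coeff_eq g g.order fun γ' h' => HahnSeries.coeff_eq_zero_of_lt_order h'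
    have h2 : g.order < -L.slope p j := (HahnSeries.order_le_of_coeff_ne_zero h0).trans_lt hγ
    rw [hg, HahnSeries.coeff_single_of_ne (L.strictMono_minVal hp h2).ne, eq_comm,
      mul_eq_zero] at h1
    refine h1.elim (RatFunc.algebraMap_ne_zero (L.facePoly_ne_zero _)) fun h => h0 ?_
    rw [HahnSeries.coeff_order_eq_zero.mp h, HahnSeries.coeff_zero]
  set N := L.expSum p j c + L.expMult p j c with hN
  let w := L.lossUpTo p j c
  have hw : ∀ γ, w γ ≤ N := L.lossUpTo_le hj c
  change g.coeff γ ∈ powIdeal (c : ℂ) (N - w γ)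
  by_contra hbad
  let B : Set ℚ := {γ | g.coeff γ ∉ powIdeal (c : ℂ) (N - w γ)}
  have hBs : B ⊆ g.support := fun γ hγ h0 => hγ (by rw [h0]; exact zero_mem _)
  have hwf : B.IsWF := g.isWF_support.mono hBs
  have hne : B.Nonempty := ⟨γ, hbad⟩
  have hmem := hwf.min_mem hne
  have hmin : ∀ γ' < hwf.min hne, g.coeff γ' ∈ powIdeal (c : ℂ) (N - w γ') := by
    intro γ' h'
    by_contra h
    exact hwf.not_lt_min hne (show γ' ∈ B from h) h'
  generalize hwf.min hne = β at *
  have hβ : -L.slope p j ≤ β := by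
    by_contra! h
    exact hBs hmem (hvan β h)
  have hloss : ∀ γ' < β, w γ' + (L.facePoly p β).rootMultiplicity (c : ℂ) ≤ w β := fun γ' h' =>
    L.lossUpTo_add_le hp hj c hβ h'
  -- Any exponent below β would do: this gives r ≤ w(β), so that the natural subtractions are exact.
  have hr := hloss (β - 1) (by linarith)
  have hwβ := hw β
  set r := (L.facePoly p β).rootMultiplicity (c : ℂ) with hrdef
  have hk : N - (w β - r) - r = N - w β := by omega
  refine hmem ?_
  rw [← hk]
  refine mem_powIdeal_of_mul_mem (L.facePoly_ne_zero β) (by omega) ?_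
  -- Splitting off the terms below β leaves a series starting at β or later, whose image has P_β g_β
  -- as its coefficient at T(β).
  set g₁ := HahnSeries.truncLT β g with hg₁
  have hg₁mem : ∀ γ', g₁.coeff γ' ∈ powIdeal (c : ℂ) (N - (w β - r)) := by
    intro γ'
    rw [hg₁, HahnSeries.coeff_truncLT]
    split_ifs with h'
    · have := hloss γ' h'
      exact powIdeal_anti _ (by omega) (hmin γ' h')
    · exact zero_mem _
  have hdiff := hlead.coeff_eq (g - g₁) β fun γ' h' => by
    rw [HahnSeries.coeff_sub, hg₁, HahnSeries.coeff_truncLT, if_pos h', sub_self]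
  have hgβ : (g - g₁).coeff β = g.coeff β := by
    rw [HahnSeries.coeff_sub, hg₁, HahnSeries.coeff_truncLT, if_neg (lt_irrefl _), sub_zero]
  rw [hgβ] at hdiff
  rw [← hdiff, map_sub, HahnSeries.coeff_sub]
  refine sub_mem ?_ (L.twist_coeff_mem hp _ hg₁mem _)
  rw [hg, HahnSeries.coeff_single]
  split_ifs
  · exact powIdeal_anti _ (Nat.sub_le _ _) (mem_powIdeal.mpr ⟨1, one_mem _, one_mul _⟩)
  · exact zero_mem _

end MahlerOperator

theorem C_single_pow_mul (δ : ℚ) (q : RatFunc ℂ) (N : ℕ) (y : RLam) :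
    MvPolynomial.C (HahnSeries.single δ (q ^ N)) * y =
      MvPolynomial.C (HahnSeries.C q) ^ N * (MvPolynomial.C (HahnSeries.single δ 1) * y) := by
  have : HahnSeries.single δ (q ^ N) = HahnSeries.C q ^ N * HahnSeries.single δ 1 := by
    rw [← map_pow, HahnSeries.C_apply, HahnSeries.single_mul_single, zero_add, mul_one]
  rw [this, map_mul, map_pow, mul_assoc]

end MahlerFrobenius

open MahlerFrobenius in
theorem mainTheorem5 {p : ℕ} (hp : 2 ≤ p)
    {R : Type*} [CommRing R] [Algebra (Hahn ℂ) R] (S : SolutionRing hp R)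
    (L : MahlerOperator)
    (j : ℕ) (hj : 1 ≤ j) (hjk : j ≤ L.numSlopes p)
    (c : ℂˣ) (hc : L.IsExponent p j c) :
    (∃! g : Hahn (RatFunc ℂ), L.FrobeniusEquation hp j c g) ∧
    ∀ g : Hahn (RatFunc ℂ), L.FrobeniusEquation hp j c g →
      MvPolynomial.C g * eLam ∈ RLamAt (c : ℂ) ∧
      ∀ m < L.expMult p j c,
        ∃ h : dLam^[L.expSum p j c + m] (MvPolynomial.C g * eLam) ∈ RLamAt (c : ℂ),
          L.apply (algebraMap (Hahn ℂ) R) (S.phi : R →+* R) (ev S c ⟨_, h⟩) = 0 := by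
  refine ⟨?_, fun g hg => ?_⟩
  · simp only [L.frobeniusEquation_iff]
    exact (L.bijective_twist hp).existsUnique _
  · have hmem : MvPolynomial.C g * eLam ∈ RLamAt (c : ℂ) := by
      refine mul_mem (C_mem_RLamAt fun γ => ?_) (X_mem_RLamAt _ 0)
      obtain ⟨u, hu, e⟩ := mem_powIdeal.mp (L.coeff_mem_powIdeal hp hj hjk c hg γ)
      rw [← e]
      exact mul_mem hu (pow_mem (X_sub_C_mem_regularAt _) _)
    refine ⟨hmem, fun m hm => ?_⟩
    have h := dLam_iterate_mem_RLamAt hmem (L.expSum p j c + m)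
    have hz : MvPolynomial.C (HahnSeries.single ((L.coeff 0).order - L.nu p j / ((p : ℚ) - 1))
        (1 : RatFunc ℂ)) * eLam ∈ RLamAt (c : ℂ) := by
      refine mul_mem (C_mem_RLamAt fun γ => ?_) (X_mem_RLamAt _ 0)
      rw [HahnSeries.coeff_single]
      split_ifs
      · exact one_mem _
      · exact zero_mem _
    -- As m < m_{c,j}, fewer than N derivatives are taken and at least one factor λ-c survives.
    obtain ⟨y', hy', e'⟩ := dLam_iterate_pow_mul c hz (L.expSum p j c + L.expMult p j c)
      (L.expSum p j c + m) (by omega)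
    rw [MahlerOperator.FrobeniusEquation, C_single_pow_mul] at hg
    have hu := (L.dLam_iterate_apply hp (L.expSum p j c + m) _).symm.trans
      ((congrArg _ hg).trans e')
    obtain ⟨h', e⟩ := MahlerOperator.apply_ev S c L h hu
    exact ⟨h, e.trans (ev_X_sub_C_mul S c
      (n := L.expSum p j c + L.expMult p j c - (L.expSum p j c + m)) (by omega) h' hy' rfl)⟩
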